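/- **Notation.** Let $\mathcal M_d$ be the complex $d\times d$ matrices and $\mathcal A_d^+\subset\mathcal M_d$ the positive definite ones. A *state* is a positive semidefinite matrix of trace $1$. Let $\mathcal L:\mathcal M_d\to\mathcal M_d$ be a Liouvillian in Lindblad form (Heisenberg picture), $$\mathcal L(f)=i[H,f]+\sum_i\Big(L_i^\dagger fL_i-\tfrac12\{L_i^\dagger L_i,f\}\Big),\qquad H=H^\dagger,$$ with dual $\mathcal L^*$ for the Hilbert–Schmidt inner product $\operatorname{tr}(A^\dagger B)$. Assume that $\mathcal L$ is primitive with stationary state $\sigma$: the state $\sigma$ is positive definite and is the only state with $\mathcal L^*(\sigma)=0$. For real $s$ put $\Gamma_\sigma^s(f)=\sigma^{s/2}f\sigma^{s/2}$, $\Gamma_\sigma=\Gamma_\sigma^1$, and put $\langle f,g\rangle_\sigma=\operatorname{tr}(\Gamma_\sigma(f)g)$, $\|f\|_{2,\sigma}^2=\operatorname{tr}|\Gamma_\sigma^{1/2}(f)|^2$ and $$I_{p,q}(f)=\Gamma_\sigma^{-1/p}\big(|\Gamma_\sigma^{1/q}(f)|^{q/p}\big).$$ For $f\in\mathcal A_d^+$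 and a linear map $\mathcal K$ on $\mathcal M_d$, the $\mathbb L_p$ Dirichlet form of $\mathcal K$ is $$\mathcal E_p^{\mathcal K}(f)=-\frac{p}{2(p-1)}\big\langle I_{q,p}(f),\mathcal K(f)\big\rangle_\sigma\quad\Big(p>1,\ \tfrac1p+\tfrac1q=1\Big),$$ $$\mathcal E_1^{\mathcal K}(f)=-\tfrac12\operatorname{tr}\big(\Gamma_\sigma(\mathcal K(f))(\log\Gamma_\sigma(f)-\log\sigma)\big).$$ Write $\mathcal E_p=\mathcal E_p^{\mathcal L}$ and $\hat{\mathcal E}_p=\mathcal E_p^{\hat{\mathcal L}}$, where $\hat{\mathcal L}=\Gamma_\sigma^{-1}\circ\mathcal L^*\circ\Gamma_\sigma$. With $X=\Gamma_\sigma^{1/2}(f)$ let $$\mathrm{Ent}_2(f)=\operatorname{tr}(X^2\log X)-\tfrac12\operatorname{tr}(X^2\log\sigma)-\tfrac12\|f\|_{2,\sigma}^2\log\|f\|_{2,\sigma}^2 .$$ $\mathcal L$ is *weakly $\mathbb L_p$-regular* if for all $f\in\mathcal A_d^+$ $$\mathcal E_p(f)\ge\mathcal E_2(I_{2,p}(f))\quad(1\le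 p\le2),\qquad \mathcal E_p(f)\ge\frac1{p-1}\,\mathcal E_2(I_{2,p}(f))\quad(p\ge2),$$ and *strongly $\mathbb L_p$-regular* if $\mathcal E_p(f)\ge\frac2p\,\mathcal E_2(I_{2,p}(f))$ for all $p\ge1$ and all $f\in\mathcal A_d^+$. **Lemma.** Let $\alpha_2>0$ be such that $\alpha_2\,\mathrm{Ent}_2(f)\le\hat{\mathcal E}_2(f)$ for all $f\in\mathcal A_d^+$. Let $\sigma_{\min}$ be the smallest eigenvalue of $\sigma$ and $\|A\|_{tr}=\operatorname{tr}|A|$. For a state $\rho_0$ and $t\ge0$ let $\rho_t=e^{t\mathcal L^*}(\rho_0)$. 1. If $\mathcal L$ is weakly $\mathbb L_p$-regular, then for every state $\rho_0$ and every $t\ge0$ $$\|\rho_t-\sigma\|_{tr}\le\sqrt{2\log(1/\sigma_{\min})}\;e^{-\alpha_2t/2}.$$ 2. If $\mathcal L$ is strongly $\mathbb L_p$-regular, then for every state $\rho_0$ and every $t\ge0$ $$\|\rho_t-\sigma\|_{tr}\le\sqrt{2\log(1/\sigma_{\min})}\;e^{-\alpha_2t}.$$ -/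

import Mathlib

open scoped ComplexOrder

noncomputable section

namespace LogSobolev

/-- The algebra of `d × d` complex matrices. -/
abbrev Mat (d : ℕ) : Type := Matrix (Fin d) (Fin d) ℂ

/-- Linear maps of the matrix algebra into itself. -/
abbrev Superop (d : ℕ) : Type := Mat d →ₗ[ℂ] Mat d

variable {d : ℕ}

/-- A state (density matrix): positive semidefinite of trace one. -/
def IsState (ρ : Mat d) : Prop := ρ.PosSemidef ∧ ρ.trace = 1

/-- A full rank state: positive definite of trace one. -/
def IsFullRankState (σ : Mat d) : Prop := σ.PosDef ∧ σ.trace = 1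

/-- The real power `A ^ s` of a positive definite matrix, by functional calculus. -/
def mpow (A : Mat d) (s : ℝ) : Mat d := cfc (fun x : ℝ => x ^ s) A

/-- The power `|A| ^ s` of the absolute value of a Hermitian matrix, by functional calculus. -/
def absPow (A : Mat d) (s : ℝ) : Mat d := cfc (fun x : ℝ => |x| ^ s) A

/-- The logarithm of a positive definite matrix, by functional calculus. -/
def mlog (A : Mat d) : Mat d := cfc Real.log A

/-- The trace norm `tr |A|`, where `|A| = (A† A) ^ (1/2)`. -/
def traceNorm (A : Mat d) : ℝ := (cfc Real.sqrt (A.conjTranspose * A)).trace.re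

/-- The smallest eigenvalue of a Hermitian matrix. -/
def minEigenvalue (A : Mat d) : ℝ := sInf (spectrum ℝ A)

/-- The weighting map `Γ_σ^s (f) = σ^{s/2} f σ^{s/2}`. -/
def weight (σ : Mat d) (s : ℝ) : Superop d :=
  LinearMap.mulLeft ℂ (mpow σ (s / 2)) ∘ₗ LinearMap.mulRight ℂ (mpow σ (s / 2))

/-- The weighted inner product `⟨f, g⟩_σ = tr (Γ_σ(f) g)` (a real number for Hermitian `f`, `g`). -/
def wInner (σ f g : Mat d) : ℝ := (weight σ 1 f * g).trace.re

/-- The weighted norm `‖f‖_{p,σ} = (tr |Γ_σ^{1/p}(f)|^p)^{1/p}` of a Hermitian matrix. -/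
def wNorm (σ : Mat d) (p : ℝ) (f : Mat d) : ℝ :=
  (absPow (weight σ (1 / p) f) p).trace.re ^ (1 / p)

/-- The power operator `I_{p,q}(f) = Γ_σ^{-1/p} (|Γ_σ^{1/q}(f)|^{q/p})`. -/
def powOp (σ : Mat d) (p q : ℝ) (f : Mat d) : Mat d :=
  weight σ (-(1 / p)) (absPow (weight σ (1 / q) f) (q / p))

/-- The `L_2` relative entropy of a positive definite matrix `f`; with `X = Γ_σ^{1/2}(f)` it is
`tr (X² log X) - (1/2) tr (X² log σ) - (1/2) ‖f‖²_{2,σ} log ‖f‖²_{2,σ}`. -/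
def ent2 (σ f : Mat d) : ℝ :=
  ((weight σ (1 / 2) f) ^ 2 * mlog (weight σ (1 / 2) f)).trace.re
    - 1 / 2 * ((weight σ (1 / 2) f) ^ 2 * mlog σ).trace.re
    - 1 / 2 * wNorm σ 2 f ^ 2 * Real.log (wNorm σ 2 f ^ 2)

/-- Lindblad generators in the Heisenberg picture:
`L(f) = i[H, f] + ∑ᵢ (Lᵢ† f Lᵢ - (1/2) {Lᵢ† Lᵢ, f})` with `H` Hermitian. -/
def IsLiouvillian (L : Superop d) : Prop :=
  ∃ (H : Mat d) (k : ℕ) (V : Fin k → Mat d), H.IsHermitian ∧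
    ∀ f : Mat d, L f = Complex.I • (H * f - f * H)
      + ∑ i, ((V i).conjTranspose * f * V i
        - (1 / 2 : ℂ) • ((V i).conjTranspose * V i * f + f * ((V i).conjTranspose * V i)))

/-- The dual `L^*` with respect to the Hilbert-Schmidt inner product `tr (A† B)`: in the basis of
matrix units, which is orthonormal, it is the conjugate transpose of the matrix of `L`. -/
def hsDual (L : Superop d) : Superop d :=
  Matrix.toLin (Matrix.stdBasis ℂ (Fin d) (Fin d)) (Matrix.stdBasis ℂ (Fin d) (Fin d))
    (LinearMap.toMatrix (Matrix.stdBasis ℂ (Fin d) (Fin d))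
      (Matrix.stdBasis ℂ (Fin d) (Fin d)) L).conjTranspose

/-- The exponential `exp(t L)` of a linear map `t L` (computed in the basis of matrix units). -/
def expSemigroup (L : Superop d) (t : ℝ) : Superop d :=
  Matrix.toLin (Matrix.stdBasis ℂ (Fin d) (Fin d)) (Matrix.stdBasis ℂ (Fin d) (Fin d))
    (NormedSpace.exp ((t : ℂ) • LinearMap.toMatrix (Matrix.stdBasis ℂ (Fin d) (Fin d))
      (Matrix.stdBasis ℂ (Fin d) (Fin d)) L))

/-- `L` is primitive with stationary state `σ`: the state `σ` has full rank, and it is the one and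
only state with `L^*(σ) = 0`. -/
def IsPrimitive (L : Superop d) (σ : Mat d) : Prop :=
  IsFullRankState σ ∧ hsDual L σ = 0 ∧ ∀ ρ : Mat d, IsState ρ → hsDual L ρ = 0 → ρ = σ

/-- The dual of `L` for the `σ`-weighted inner product, `Γ_σ⁻¹ ∘ L^* ∘ Γ_σ`; it generates the
evolution of relative densities. -/
def relDual (σ : Mat d) (L : Superop d) : Superop d :=
  weight σ (-1) ∘ₗ hsDual L ∘ₗ weight σ 1

/-- The `L_p` Dirichlet form of a positive definite matrix `f`. For `p > 1` it is
`-p / (2 (p - 1)) ⟨I_{q,p}(f), L(f)⟩_σ` with `1/p + 1/q = 1`; for `p = 1` it is the limit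
`-(1/2) tr (Γ_σ(L(f)) (log Γ_σ(f) - log σ))` of these forms. -/
def dirichletForm (σ : Mat d) (L : Superop d) (p : ℝ) (f : Mat d) : ℝ :=
  if p = 1 then
    -(1 / 2) * (weight σ 1 (L f) * (mlog (weight σ 1 f) - mlog σ)).trace.re
  else
    -p / (2 * (p - 1)) * wInner σ (powOp σ (p / (p - 1)) p f) (L f)

/-- Weak `L_p`-regularity: `E_p(f) ≥ E_2(I_{2,p}(f))` for `1 ≤ p ≤ 2` and
`E_p(f) ≥ (p - 1)⁻¹ E_2(I_{2,p}(f))` for `p ≥ 2`, for all positive definite `f`. -/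
def WeaklyRegular (σ : Mat d) (L : Superop d) : Prop :=
  ∀ f : Mat d, f.PosDef → ∀ p : ℝ,
    (1 ≤ p → p ≤ 2 →
      dirichletForm σ L 2 (powOp σ 2 p f) ≤ dirichletForm σ L p f) ∧
    (2 ≤ p →
      1 / (p - 1) * dirichletForm σ L 2 (powOp σ 2 p f) ≤ dirichletForm σ L p f)

/-- Strong `L_p`-regularity: `E_p(f) ≥ (2/p) E_2(I_{2,p}(f))` for all `p ≥ 1` and all positive
definite `f`. -/
def StronglyRegular (σ : Mat d) (L : Superop d) : Prop :=
  ∀ f : Mat d, f.PosDef → ∀ p : ℝ, 1 ≤ p →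
    2 / p * dirichletForm σ L 2 (powOp σ 2 p f) ≤ dirichletForm σ L p f

/-- The `L_2` logarithmic Sobolev inequality with constant `α` for the generator `K`. -/
def LogSobolev2 (σ : Mat d) (K : Superop d) (α : ℝ) : Prop :=
  ∀ f : Mat d, f.PosDef → α * ent2 σ f ≤ dirichletForm σ K 2 f

end LogSobolev

end

/-! Let D(ρ‖σ) = tr ρ(log ρ − log σ) and g = Γ_σ^{-1}(ρ). Along the evolution, the derivative of D
is tr(L*(ρ)(log ρ − log σ)), which is −2 times the L_1 form of the dual generator at g, while
Ent_2(I_{2,1}(g)) = D/2. If that L_1 form is at least c·E_2(I_{2,1}(g)), the log-Sobolev inequality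
makes the derivative at most −cα₂D, so D decays like e^{-cα₂t}. Pinsker's inequality and D(ρ₀‖σ) ≤
log(1/σ_min) then bound the trace norm with rate cα₂/2; weak regularity gives c = 1 and strong
regularity c = 2.

The point is that regularity is assumed for L, whereas the evolution of densities calls for its
dual. The form E_p of L at I_{p,q}(g) pairs g with L(I_{p,q}(g)), so moving L across the trace gives
a form of the dual at the conjugate exponent q. Hence regularity of L as p → ∞ controls the dual as
q → 1 (`regularity_limit`). With s = 1/p one has I_{p,q}(g) = 1 + s(log ρ − log σ) + o(s); as tr
L*(ρ) = 0, the right side of the regularity estimate is of order s, like its coefficient, and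
division by s yields the constant c. The E_2 forms of L and of its dual agree on positive definite
matrices.

Logarithms require full rank. Full rank persists under the evolution (`expSemigroup_posDef`), and
other initial states are reached by mixing with σ (`traceNorm_le_of_forall_fullRank`). -/

noncomputable section

namespace LogSobolev

open scoped Matrix

variable {d : ℕ}

/-! ### Powers, logarithms, weights and power operators of positive definite matrices. -/

section FunctionalCalculus

theorem continuousOn_real_spectrum (A : Mat d) (f : ℝ → ℝ) :
    ContinuousOn f (spectrum ℝ A) :=
  (Matrix.finite_real_spectrum (A := A)).continuousOn f

theorem posDef_iff_spectrum_pos {A : Mat d} :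
    A.PosDef ↔ A.IsHermitian ∧ ∀ x ∈ spectrum ℝ A, 0 < x := by
  constructor
  · intro h
    refine ⟨h.1, ?_⟩
    rw [h.1.spectrum_real_eq_range_eigenvalues]
    rintro _ ⟨i, rfl⟩
    exact h.eigenvalues_pos i
  · rintro ⟨h, hx⟩
    rw [h.posDef_iff_eigenvalues_pos]
    intro i
    exact hx _ (h.eigenvalues_mem_spectrum_real i)

theorem spectrum_pos {A : Mat d} (h : A.PosDef) {x : ℝ} (hx : x ∈ spectrum ℝ A) : 0 < x :=
  (posDef_iff_spectrum_pos.1 h).2 x hx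

theorem cfc_isHermitian (f : ℝ → ℝ) (A : Mat d) : (cfc f A).IsHermitian :=
  cfc_predicate (p := IsSelfAdjoint) f A

theorem cfc_mul_cfc (f g : ℝ → ℝ) (A : Mat d) :
    cfc f A * cfc g A = cfc (fun x => f x * g x) A :=
  (cfc_mul f g A (continuousOn_real_spectrum A f) (continuousOn_real_spectrum A g)).symm

theorem cfc_cfc (f g : ℝ → ℝ) {A : Mat d} (hA : A.IsHermitian) :
    cfc f (cfc g A) = cfc (fun x => f (g x)) A :=
  (cfc_comp' f g A ((Matrix.finite_real_spectrum (A := A)).image g |>.continuousOn f)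
    (continuousOn_real_spectrum A g) hA).symm

theorem cfc_posDef {f : ℝ → ℝ} {A : Mat d} (hA : A.IsHermitian)
    (hf : ∀ x ∈ spectrum ℝ A, 0 < f x) : (cfc f A).PosDef := by
  refine posDef_iff_spectrum_pos.2 ⟨cfc_isHermitian f A, ?_⟩
  rw [cfc_map_spectrum f A (hf := continuousOn_real_spectrum A f) (ha := hA.isSelfAdjoint)]
  rintro _ ⟨x, hx, rfl⟩
  exact hf x hx

theorem mlog_isHermitian (A : Mat d) : (mlog A).IsHermitian := cfc_isHermitian _ A

theorem mpow_isHermitian (A : Mat d) (s : ℝ) : (mpow A s).IsHermitian := cfc_isHermitian _ A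

theorem mpow_posDef {A : Mat d} (hA : A.PosDef) (s : ℝ) : (mpow A s).PosDef :=
  cfc_posDef hA.1 fun _ hx => Real.rpow_pos_of_pos (spectrum_pos hA hx) s

theorem absPow_eq_mpow {A : Mat d} (hA : A.PosDef) (s : ℝ) : absPow A s = mpow A s :=
  cfc_congr fun x hx => by simp only [abs_of_pos (spectrum_pos hA hx)]

theorem mpow_zero {A : Mat d} (hA : A.PosDef) : mpow A 0 = 1 := by
  have : mpow A 0 = cfc (fun _ : ℝ => (1 : ℝ)) A := cfc_congr fun x _ => Real.rpow_zero x
  exact this.trans (cfc_const_one ℝ A hA.1.isSelfAdjoint)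

theorem mpow_one {A : Mat d} (hA : A.PosDef) : mpow A 1 = A := by
  have : mpow A 1 = cfc (fun x : ℝ => x) A := cfc_congr fun x _ => Real.rpow_one x
  exact this.trans (cfc_id' ℝ A hA.1.isSelfAdjoint)

theorem mpow_mul_mpow {A : Mat d} (hA : A.PosDef) (s t : ℝ) :
    mpow A s * mpow A t = mpow A (s + t) := by
  rw [mpow, mpow, mpow, cfc_mul_cfc]
  exact cfc_congr fun x hx => (Real.rpow_add (spectrum_pos hA hx) s t).symm

theorem mpow_mpow {A : Mat d} (hA : A.PosDef) (s t : ℝ) :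
    mpow (mpow A s) t = mpow A (s * t) := by
  rw [mpow, mpow, mpow, cfc_cfc _ _ hA.1]
  exact cfc_congr fun x hx => (Real.rpow_mul (spectrum_pos hA hx).le s t).symm

theorem mlog_mpow {A : Mat d} (hA : A.PosDef) (s : ℝ) :
    mlog (mpow A s) = s • mlog A := by
  rw [mpow, mlog, mlog, cfc_cfc _ _ hA.1,
    ← cfc_smul s Real.log A (continuousOn_real_spectrum A _)]
  exact cfc_congr fun x hx => Real.log_rpow (spectrum_pos hA hx) s

theorem weight_apply (σ : Mat d) (s : ℝ) (f : Mat d) :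
    weight σ s f = mpow σ (s / 2) * f * mpow σ (s / 2) := by
  simp [weight, mul_assoc]

theorem weight_weight {σ : Mat d} (hσ : σ.PosDef) (s t : ℝ) (f : Mat d) :
    weight σ s (weight σ t f) = weight σ (s + t) f := by
  simp only [weight_apply]
  calc _ = (mpow σ (s / 2) * mpow σ (t / 2)) * f * (mpow σ (t / 2) * mpow σ (s / 2)) := by
        simp only [mul_assoc]
    _ = _ := by
        rw [mpow_mul_mpow hσ, mpow_mul_mpow hσ, add_comm (t / 2), ← add_div]

theorem weight_zero {σ : Mat d} (hσ : σ.PosDef) (f : Mat d) : weight σ 0 f = f := by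
  simp [weight_apply, mpow_zero hσ]

theorem weight_posDef {σ : Mat d} (hσ : σ.PosDef) (s : ℝ) {f : Mat d} (hf : f.PosDef) :
    (weight σ s f).PosDef := by
  have hu : IsUnit (mpow σ (s / 2)) := (mpow_posDef hσ _).isUnit
  have := (Matrix.IsUnit.posDef_star_right_conjugate_iff hu (x := f)).2 hf
  rwa [Matrix.star_eq_conjTranspose, (mpow_isHermitian σ _).eq, ← weight_apply] at this

theorem trace_weight_mul (σ : Mat d) (s : ℝ) (f g : Mat d) :
    (weight σ s f * g).trace = (f * weight σ s g).trace := by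
  simp only [weight_apply]
  rw [mul_assoc, mul_assoc, Matrix.trace_mul_comm]
  simp only [mul_assoc]

theorem powOp_eq {σ : Mat d} (hσ : σ.PosDef) (p q : ℝ) {f : Mat d} (hf : f.PosDef) :
    powOp σ p q f = weight σ (-(1 / p)) (mpow (weight σ (1 / q) f) (q / p)) := by
  rw [powOp, absPow_eq_mpow (weight_posDef hσ _ hf)]

theorem powOp_posDef {σ : Mat d} (hσ : σ.PosDef) (p q : ℝ) {f : Mat d} (hf : f.PosDef) :
    (powOp σ p q f).PosDef := by
  rw [powOp_eq hσ p q hf]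
  exact weight_posDef hσ _ (mpow_posDef (weight_posDef hσ _ hf) _)

theorem powOp_powOp {σ : Mat d} (hσ : σ.PosDef) (p : ℝ) {q : ℝ} (hq : q ≠ 0) (r : ℝ)
    {f : Mat d} (hf : f.PosDef) :
    powOp σ p q (powOp σ q r f) = powOp σ p r f := by
  have hX := weight_posDef hσ (1 / r) hf
  rw [powOp_eq hσ p q (powOp_posDef hσ q r hf), powOp_eq hσ q r hf, powOp_eq hσ p r hf,
    weight_weight hσ, add_neg_cancel, weight_zero hσ, mpow_mpow hX]
  rw [show r / q * (q / p) = r / p by field_simp]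

theorem powOp_self {σ : Mat d} (hσ : σ.PosDef) {p : ℝ} (hp : p ≠ 0)
    {f : Mat d} (hf : f.PosDef) : powOp σ p p f = f := by
  rw [powOp_eq hσ p p hf, div_self hp, mpow_one (weight_posDef hσ _ hf), weight_weight hσ,
    neg_add_cancel, weight_zero hσ]

end FunctionalCalculus

/-! ### Continuity of the logarithm and openness of positivity. -/

section Continuity

open scoped Matrix.Norms.L2Operator

/-- Reduces joint limits and derivatives in base and exponent to those of `exp` and of the
logarithm. -/
theorem mpow_eq_exp {A : Mat d} (hA : A.PosDef) (s : ℝ) :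
    mpow A s = NormedSpace.exp (s • mlog A) := by
  have h : (s • mlog A : Mat d).IsHermitian := by
    have := (mlog_isHermitian A)
    rw [Matrix.IsHermitian, Matrix.conjTranspose_smul, this.eq]; simp
  rw [← CFC.real_exp_eq_normedSpace_exp (a := (s • mlog A : Mat d)) h, ← mlog_mpow hA, mlog,
    cfc_cfc _ _ (mpow_isHermitian A s), mpow, cfc_cfc _ _ hA.1]
  exact cfc_congr fun x hx =>
    (Real.exp_log (Real.rpow_pos_of_pos (spectrum_pos hA hx) s)).symm

theorem isOpen_setOf_posSpectrum : IsOpen {A : Mat d | ∀ x ∈ spectrum ℝ A, 0 < x} := by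
  have := (upperHemicontinuous_spectrum ℝ (Mat d)).isOpen (Set.Ioi 0)
  simp only [isOpen_Ioi.mem_nhdsSet] at this
  exact this

theorem eventually_posDef {X : Type*} {l : Filter X} {a : X → Mat d} {A : Mat d}
    (ha : Filter.Tendsto a l (nhds A)) (hA : A.PosDef) (hh : ∀ x, (a x).IsHermitian) :
    ∀ᶠ x in l, (a x).PosDef := by
  have := ha (isOpen_setOf_posSpectrum.mem_nhds (posDef_iff_spectrum_pos.1 hA).2)
  filter_upwards [this] with x hx
  exact posDef_iff_spectrum_pos.2 ⟨hh x, hx⟩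

theorem tendsto_mlog {X : Type*} {l : Filter X} {a : X → Mat d} {A : Mat d}
    (ha : Filter.Tendsto a l (nhds A)) (hA : A.PosDef) (hh : ∀ᶠ x in l, (a x).PosDef) :
    Filter.Tendsto (fun x => mlog (a x)) l (nhds (mlog A)) := by
  have h := CFC.continuousOn_log (A := Mat d)
  have h2 := h A ⟨hA.1, hA.isUnit⟩
  refine h2.tendsto.comp (tendsto_nhdsWithin_iff.2 ⟨ha, ?_⟩)
  · filter_upwards [hh] with x hx
    exact ⟨hx.1, hx.isUnit⟩

end Continuity

/-- The quantum relative entropy `tr (ρ (log ρ - log σ))`. -/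
def relEnt (ρ σ : Mat d) : ℝ := (ρ * (mlog ρ - mlog σ)).trace.re

/-! ### Spectral double sums, Klein's and Pinsker's inequalities, and the initial entropy bound. -/

theorem cfc_eq_conj_diagonal (f : ℝ → ℝ) {A : Mat d} (hA : A.IsHermitian) :
    cfc f A = (hA.eigenvectorUnitary : Mat d) *
      Matrix.diagonal (fun i => ((f (hA.eigenvalues i) : ℝ) : ℂ)) *
        (hA.eigenvectorUnitary : Mat d)ᴴ := by
  rw [hA.cfc_eq, Matrix.IsHermitian.cfc, Unitary.conjStarAlgAut_apply]
  rfl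

theorem conjTranspose_eigenvectorUnitary_mul {A : Mat d} (hA : A.IsHermitian) :
    (hA.eigenvectorUnitary : Mat d)ᴴ * (hA.eigenvectorUnitary : Mat d) = 1 :=
  Unitary.coe_star_mul_self hA.eigenvectorUnitary

theorem eigenvectorUnitary_mul_conjTranspose {A : Mat d} (hA : A.IsHermitian) :
    (hA.eigenvectorUnitary : Mat d) * (hA.eigenvectorUnitary : Mat d)ᴴ = 1 :=
  Unitary.coe_mul_star_self hA.eigenvectorUnitary

/-- The matrix of `X` with respect to the eigenbases of `A` and of `B`. -/
def eigenMatrix {A B : Mat d} (hA : A.IsHermitian) (hB : B.IsHermitian) (X : Mat d) : Mat d :=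
  (hA.eigenvectorUnitary : Mat d)ᴴ * X * (hB.eigenvectorUnitary : Mat d)

/-- Expanding in the two eigenbases turns traces involving noncommuting A and B into sums over pairs
of eigenvalues with nonnegative weights. Scalar inequalities in two variables thereby become trace
inequalities. -/
theorem trace_cfc_mul_mul_cfc_mul {A B : Mat d} (hA : A.IsHermitian) (hB : B.IsHermitian)
    (f g : ℝ → ℝ) (X : Mat d) :
    (cfc f A * X * cfc g B * Xᴴ).trace.re =
      ∑ i, ∑ j, f (hA.eigenvalues i) * g (hB.eigenvalues j) *
        ‖eigenMatrix hA hB X i j‖ ^ 2 := by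
  set N := eigenMatrix hA hB X with hN
  have h : (cfc f A * X * cfc g B * Xᴴ).trace =
      (Matrix.diagonal (fun i => ((f (hA.eigenvalues i) : ℝ) : ℂ)) * N *
        (Matrix.diagonal (fun i => ((g (hB.eigenvalues i) : ℝ) : ℂ)) * Nᴴ)).trace := by
    rw [cfc_eq_conj_diagonal f hA, cfc_eq_conj_diagonal g hB, hN, eigenMatrix]
    simp only [mul_assoc, Matrix.conjTranspose_mul, Matrix.conjTranspose_conjTranspose]
    rw [Matrix.trace_mul_comm]
    simp only [mul_assoc]
  rw [h, Matrix.trace, Complex.re_sum]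
  refine Finset.sum_congr rfl fun i _ => ?_
  rw [Matrix.diag_apply, Matrix.mul_apply, Complex.re_sum]
  refine Finset.sum_congr rfl fun j _ => ?_
  rw [Matrix.diagonal_mul, Matrix.diagonal_mul, Matrix.conjTranspose_apply,
    ← Complex.normSq_eq_norm_sq]
  have : ((f (hA.eigenvalues i) : ℝ) : ℂ) * N i j * (((g (hB.eigenvalues j) : ℝ) : ℂ) * star (N i j))
      = ((f (hA.eigenvalues i) * g (hB.eigenvalues j) * Complex.normSq (N i j) : ℝ) : ℂ) := by
    push_cast
    rw [Complex.normSq_eq_conj_mul_self]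
    simp only [RCLike.star_def]
    ring
  rw [this, Complex.ofReal_re]

theorem trace_cfc_mul_cfc {A B : Mat d} (hA : A.IsHermitian) (hB : B.IsHermitian)
    (f g : ℝ → ℝ) :
    (cfc f A * cfc g B).trace.re =
      ∑ i, ∑ j, f (hA.eigenvalues i) * g (hB.eigenvalues j) *
        ‖eigenMatrix hA hB 1 i j‖ ^ 2 := by
  have := trace_cfc_mul_mul_cfc_mul hA hB f g 1
  simpa using this

theorem cfc_id_eq {A : Mat d} (hA : A.IsHermitian) : cfc (fun x : ℝ => x) A = A :=
  cfc_id' ℝ A hA.isSelfAdjoint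

theorem cfc_one_eq {A : Mat d} (hA : A.IsHermitian) : cfc (fun _ : ℝ => (1 : ℝ)) A = 1 :=
  cfc_const_one ℝ A hA.isSelfAdjoint

theorem relEnt_eq_sum {A B : Mat d} (hA : A.IsHermitian) (hB : B.IsHermitian) :
    relEnt A B = ∑ i, ∑ j, (hA.eigenvalues i * Real.log (hA.eigenvalues i)
      - hA.eigenvalues i * Real.log (hB.eigenvalues j)) * ‖eigenMatrix hA hB 1 i j‖ ^ 2 := by
  have h1 := trace_cfc_mul_cfc hA hB (fun x => x * Real.log x) (fun _ => 1)
  have h2 := trace_cfc_mul_cfc hA hB (fun x => x) Real.log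
  rw [cfc_one_eq hB, mul_one, ← cfc_mul_cfc (fun x => x) Real.log, cfc_id_eq hA] at h1
  rw [cfc_id_eq hA] at h2
  rw [relEnt, mul_sub, Matrix.trace_sub, Complex.sub_re, mlog, mlog, h1, h2,
    ← Finset.sum_sub_distrib]
  refine Finset.sum_congr rfl fun i _ => ?_
  rw [← Finset.sum_sub_distrib]
  refine Finset.sum_congr rfl fun j _ => ?_
  ring

theorem trace_eq_sum_left {A B : Mat d} (hA : A.IsHermitian) (hB : B.IsHermitian) :
    A.trace.re = ∑ i, ∑ j, hA.eigenvalues i * ‖eigenMatrix hA hB 1 i j‖ ^ 2 := by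
  have h1 := trace_cfc_mul_cfc hA hB (fun x => x) (fun _ => 1)
  rw [cfc_one_eq hB, mul_one, cfc_id_eq hA] at h1
  simpa using h1

theorem trace_eq_sum_right {A B : Mat d} (hA : A.IsHermitian) (hB : B.IsHermitian) :
    B.trace.re = ∑ i, ∑ j, hB.eigenvalues j * ‖eigenMatrix hA hB 1 i j‖ ^ 2 := by
  have h1 := trace_cfc_mul_cfc hA hB (fun _ => 1) (fun x => x)
  rw [cfc_one_eq hA, one_mul, cfc_id_eq hB] at h1
  simpa using h1

theorem relEnt_sub_trace_eq_sum {A B : Mat d} (hA : A.IsHermitian) (hB : B.IsHermitian) :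
    relEnt A B - A.trace.re + B.trace.re = ∑ i, ∑ j,
      (hA.eigenvalues i * Real.log (hA.eigenvalues i)
        - hA.eigenvalues i * Real.log (hB.eigenvalues j) - hA.eigenvalues i + hB.eigenvalues j)
        * ‖eigenMatrix hA hB 1 i j‖ ^ 2 := by
  rw [relEnt_eq_sum hA hB, trace_eq_sum_left hA hB, trace_eq_sum_right hA hB,
    ← Finset.sum_sub_distrib, ← Finset.sum_add_distrib]
  refine Finset.sum_congr rfl fun i _ => ?_
  rw [← Finset.sum_sub_distrib, ← Finset.sum_add_distrib]
  refine Finset.sum_congr rfl fun j _ => ?_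
  ring

/-- The scalar inequality behind the proof of Pinsker's inequality. -/
theorem log_ge_rational {u : ℝ} (hu : 0 < u) :
    (u - 1) * (5 * u + 1) / (2 * u * (u + 2)) ≤ Real.log u := by
  let h : ℝ → ℝ := fun u => Real.log u - (u - 1) * (5 * u + 1) / (2 * u * (u + 2))
  -- The derivative changes sign only at 1, so h has its minimum there, with value 0.
  have hd : ∀ x : ℝ, 0 < x → HasDerivAt h ((x - 1) ^ 3 / (x ^ 2 * (x + 2) ^ 2)) x := by
    intro x hx
    have e1 : HasDerivAt (fun u : ℝ => (u - 1) * (5 * u + 1))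
        (1 * (5 * x + 1) + (x - 1) * (5 * 1)) x :=
      ((hasDerivAt_id x).sub_const 1).mul (((hasDerivAt_id x).const_mul 5).add_const 1)
    have e2 : HasDerivAt (fun u : ℝ => 2 * u * (u + 2)) (2 * 1 * (x + 2) + 2 * x * 1) x :=
      ((hasDerivAt_id x).const_mul 2).mul ((hasDerivAt_id x).add_const 2)
    have hne : 2 * x * (x + 2) ≠ 0 := by positivity
    have := (Real.hasDerivAt_log hx.ne').sub (e1.div e2 hne)
    convert! this using 1
    field_simp
    ring
  have hz : h 1 = 0 := by simp [h]
  suffices 0 ≤ h u by simpa [h] using this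
  rw [← hz]
  rcases le_total u 1 with h1 | h1
  · have : AntitoneOn h (Set.Icc u 1) := by
      refine antitoneOn_of_deriv_nonpos (convex_Icc u 1) ?_ ?_ ?_
      · exact fun x hx => (hd x (hu.trans_le hx.1)).continuousAt.continuousWithinAt
      · intro x hx
        rw [interior_Icc] at hx
        exact (hd x (hu.trans hx.1)).differentiableAt.differentiableWithinAt
      · intro x hx
        rw [interior_Icc] at hx
        have hx0 := hu.trans hx.1
        rw [(hd x hx0).deriv]
        apply div_nonpos_of_nonpos_of_nonneg _ (by positivity)
        have : x - 1 ≤ 0 := by linarith [hx.2]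
        exact Odd.pow_nonpos (by decide) this
    exact this ⟨le_rfl, h1⟩ ⟨h1, le_rfl⟩ h1
  · have : MonotoneOn h (Set.Icc 1 u) := by
      refine monotoneOn_of_deriv_nonneg (convex_Icc 1 u) ?_ ?_ ?_
      · exact fun x hx => (hd x (one_pos.trans_le hx.1)).continuousAt.continuousWithinAt
      · intro x hx
        rw [interior_Icc] at hx
        exact (hd x (one_pos.trans hx.1)).differentiableAt.differentiableWithinAt
      · intro x hx
        rw [interior_Icc] at hx
        have hx0 : 0 < x := one_pos.trans hx.1
        rw [(hd x hx0).deriv]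
        have : 0 ≤ x - 1 := by linarith [hx.1]
        positivity
    exact this ⟨le_rfl, h1⟩ ⟨h1, le_rfl⟩ h1

/-- This is the logarithm bound at u = x/y multiplied by x. The weight x + 2y sums to 3 over a pair
of states, which cancels the 2/3 down to Pinsker's constant 2. -/
theorem sq_sub_le_mul_klein {x y : ℝ} (hx : 0 < x) (hy : 0 < y) :
    (x - y) ^ 2 / (x + 2 * y) ≤ 2 / 3 * (x * Real.log x - x * Real.log y - x + y) := by
  have h := log_ge_rational (div_pos hx hy)
  rw [Real.log_div hx.ne' hy.ne'] at h
  have h2 := mul_le_mul_of_nonneg_left h hx.le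
  have e : x * ((x / y - 1) * (5 * (x / y) + 1) / (2 * (x / y) * (x / y + 2)))
      = x - y + 3 / 2 * ((x - y) ^ 2 / (x + 2 * y)) := by
    field_simp
    ring
  rw [e] at h2
  linarith

theorem klein_scalar_nonneg {x y : ℝ} (hx : 0 < x) (hy : 0 < y) :
    0 ≤ x * Real.log x - x * Real.log y - x + y := by
  have h := sq_sub_le_mul_klein hx hy
  have : 0 ≤ (x - y) ^ 2 / (x + 2 * y) := by positivity
  linarith

/-- **Klein's inequality** for the relative entropy. -/
theorem klein {A B : Mat d} (hA : A.PosDef) (hB : B.PosDef) :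
    A.trace.re - B.trace.re ≤ relEnt A B := by
  have h := relEnt_sub_trace_eq_sum hA.1 hB.1
  have : 0 ≤ relEnt A B - A.trace.re + B.trace.re := by
    rw [h]
    exact Finset.sum_nonneg fun i _ => Finset.sum_nonneg fun j _ =>
      mul_nonneg (klein_scalar_nonneg (hA.eigenvalues_pos i) (hB.eigenvalues_pos j)) (sq_nonneg _)
  linarith

theorem trace_sub_mul_eq_sum {A B S : Mat d} (hA : A.IsHermitian) (hB : B.IsHermitian)
    (hS : S.IsHermitian) :
    ((A - B) * S).trace = ∑ i, ∑ j,
      (((hA.eigenvalues i - hB.eigenvalues j : ℝ) : ℂ)) * eigenMatrix hA hB 1 i j *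
        star (eigenMatrix hA hB S i j) := by
  set U := (hA.eigenvectorUnitary : Mat d) with hU
  set V := (hB.eigenvectorUnitary : Mat d) with hV
  set W := eigenMatrix hA hB 1 with hW
  set N := eigenMatrix hA hB S with hN
  have eA := cfc_eq_conj_diagonal (fun x => x) hA
  have eB := cfc_eq_conj_diagonal (fun x => x) hB
  rw [cfc_id_eq hA, ← hU] at eA
  rw [cfc_id_eq hB, ← hV] at eB
  set D : Mat d := Matrix.diagonal (fun i => ((hA.eigenvalues i : ℝ) : ℂ)) with hD
  set E : Mat d := Matrix.diagonal (fun i => ((hB.eigenvalues i : ℝ) : ℂ)) with hE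
  have hUU : Uᴴ * U = 1 := conjTranspose_eigenvectorUnitary_mul hA
  have hVV' : V * Vᴴ = 1 := eigenvectorUnitary_mul_conjTranspose hB
  have hUU' : U * Uᴴ = 1 := eigenvectorUnitary_mul_conjTranspose hA
  have hNH : Nᴴ = Vᴴ * S * U := by
    rw [hN, eigenMatrix]
    simp only [Matrix.conjTranspose_mul, Matrix.conjTranspose_conjTranspose, hS.eq, mul_assoc]
    rfl
  have hWe : W = Uᴴ * V := by rw [hW, eigenMatrix, mul_one]
  have h1 : (A * S).trace = (D * W * Nᴴ).trace := by
    calc (A * S).trace = (U * (D * Uᴴ * (V * Vᴴ) * S)).trace := by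
          rw [hVV', mul_one]; conv_lhs => rw [eA]
          simp only [mul_assoc]
      _ = _ := by
          rw [Matrix.trace_mul_comm, hNH, hWe]; simp only [mul_assoc]
  have h2 : (B * S).trace = (W * E * Nᴴ).trace := by
    calc (B * S).trace = ((U * Uᴴ) * (V * E * Vᴴ * S)).trace := by
          rw [hUU', one_mul]; conv_lhs => rw [eB]
      _ = (U * (Uᴴ * (V * E * Vᴴ * S))).trace := by simp only [mul_assoc]
      _ = _ := by
          rw [Matrix.trace_mul_comm, hNH, hWe]; simp only [mul_assoc]
  rw [sub_mul, Matrix.trace_sub, h1, h2, ← Matrix.trace_sub, ← sub_mul, Matrix.trace]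
  refine Finset.sum_congr rfl fun i _ => ?_
  rw [Matrix.diag_apply, Matrix.mul_apply]
  refine Finset.sum_congr rfl fun j _ => ?_
  rw [Matrix.sub_apply, hD, hE, Matrix.diagonal_mul, Matrix.mul_diagonal,
    Matrix.conjTranspose_apply]
  push_cast
  ring

/-- Cauchy–Schwarz over pairs of eigenvalues with weight a + 2b. The factor carrying the overlaps of
the eigenbases is bounded termwise by the relative entropy; the factor carrying S is evaluated
exactly, because S is unitary. -/
theorem sq_trace_sub_mul_le {A B S : Mat d} (hA : A.PosDef) (hB : B.PosDef)
    (hS : S.IsHermitian) (hSS : S * S = 1) :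
    (((A - B) * S).trace.re) ^ 2 ≤
      2 / 3 * (relEnt A B - A.trace.re + B.trace.re) * (A.trace.re + 2 * B.trace.re) := by
  set W := eigenMatrix hA.1 hB.1 1 with hW
  set N := eigenMatrix hA.1 hB.1 S with hN
  set a := hA.1.eigenvalues with ha
  set b := hB.1.eigenvalues with hb
  have ha0 : ∀ i, 0 < a i := hA.eigenvalues_pos
  have hb0 : ∀ i, 0 < b i := hB.eigenvalues_pos
  have hSA := trace_cfc_mul_mul_cfc_mul hA.1 hB.1 (fun x => x) (fun _ => 1) S
  have hSB := trace_cfc_mul_mul_cfc_mul hA.1 hB.1 (fun _ => 1) (fun x => x) S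
  rw [cfc_one_eq hB.1, cfc_id_eq hA.1, mul_one, hS.eq, mul_assoc, hSS, mul_one] at hSA
  rw [cfc_one_eq hA.1, cfc_id_eq hB.1, one_mul, hS.eq, mul_assoc, Matrix.trace_mul_comm,
    mul_assoc, hSS, mul_one] at hSB
  have h1 : |((A - B) * S).trace.re| ≤
      ∑ x : Fin d × Fin d, |a x.1 - b x.2| * ‖W x.1 x.2‖ * ‖N x.1 x.2‖ := by
    rw [Fintype.sum_prod_type, trace_sub_mul_eq_sum hA.1 hB.1 hS]
    refine (Complex.abs_re_le_norm _).trans ((norm_sum_le _ _).trans ?_)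
    refine Finset.sum_le_sum fun i _ => (norm_sum_le _ _).trans ?_
    refine Finset.sum_le_sum fun j _ => ?_
    rw [norm_mul, norm_mul, Complex.norm_real, norm_star, Real.norm_eq_abs]
  have h2 : (∑ x : Fin d × Fin d, |a x.1 - b x.2| * ‖W x.1 x.2‖ * ‖N x.1 x.2‖) ^ 2 ≤
      (∑ x : Fin d × Fin d, (a x.1 - b x.2) ^ 2 / (a x.1 + 2 * b x.2) * ‖W x.1 x.2‖ ^ 2) *
      (∑ x : Fin d × Fin d, (a x.1 + 2 * b x.2) * ‖N x.1 x.2‖ ^ 2) := by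
    refine Finset.sum_sq_le_sum_mul_sum_of_sq_le_mul _ ?_ ?_ ?_
    · intro x _
      have := ha0 x.1; have := hb0 x.2
      positivity
    · intro x _
      have := ha0 x.1; have := hb0 x.2
      positivity
    · intro x _
      have := ha0 x.1; have := hb0 x.2
      rw [mul_pow, mul_pow, sq_abs]
      refine le_of_eq ?_
      field_simp
  have h3 : (∑ x : Fin d × Fin d, (a x.1 - b x.2) ^ 2 / (a x.1 + 2 * b x.2) * ‖W x.1 x.2‖ ^ 2)
      ≤ 2 / 3 * (relEnt A B - A.trace.re + B.trace.re) := by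
    rw [relEnt_sub_trace_eq_sum hA.1 hB.1, Fintype.sum_prod_type, Finset.mul_sum]
    refine Finset.sum_le_sum fun i _ => ?_
    rw [Finset.mul_sum]
    refine Finset.sum_le_sum fun j _ => ?_
    rw [← mul_assoc]
    exact mul_le_mul_of_nonneg_right (sq_sub_le_mul_klein (ha0 i) (hb0 j)) (sq_nonneg _)
  have h4 : (∑ x : Fin d × Fin d, (a x.1 + 2 * b x.2) * ‖N x.1 x.2‖ ^ 2)
      = A.trace.re + 2 * B.trace.re := by
    rw [hSA, hSB, Fintype.sum_prod_type, Finset.mul_sum, ← Finset.sum_add_distrib]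
    refine Finset.sum_congr rfl fun i _ => ?_
    rw [Finset.mul_sum, ← Finset.sum_add_distrib]
    refine Finset.sum_congr rfl fun j _ => ?_
    ring
  rw [← sq_abs]
  refine (pow_le_pow_left₀ (abs_nonneg _) h1 2).trans (h2.trans ?_)
  rw [h4]
  refine mul_le_mul_of_nonneg_right h3 ?_
  rw [← h4]
  refine Finset.sum_nonneg fun x _ => ?_
  have := ha0 x.1; have := hb0 x.2
  positivity

/-- S is the sign of A, with the sign of 0 set to 1 so that S squares to the identity even when A is
singular. -/
theorem traceNorm_eq_trace_mul {A : Mat d} (hA : A.IsHermitian) :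
    ∃ S : Mat d, S.IsHermitian ∧ S * S = 1 ∧ traceNorm A = (A * S).trace.re := by
  refine ⟨cfc (fun x : ℝ => if 0 ≤ x then 1 else -1) A, cfc_isHermitian _ A, ?_, ?_⟩
  · rw [cfc_mul_cfc, ← cfc_one_eq hA]
    exact cfc_congr fun x _ => by split_ifs <;> norm_num
  · have h : A * cfc (fun x : ℝ => if 0 ≤ x then 1 else -1) A =
        cfc Real.sqrt (Aᴴ * A) := by
      have e : Aᴴ * A = cfc (fun x : ℝ => x * x) A := by
        rw [← cfc_mul_cfc, cfc_id_eq hA, hA.eq]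
      rw [e, cfc_cfc _ _ hA]
      conv_lhs => enter [1]; rw [← cfc_id_eq hA]
      rw [cfc_mul_cfc]
      refine cfc_congr fun x _ => ?_
      rw [Real.sqrt_mul_self_eq_abs]
      split_ifs with h
      · rw [abs_of_nonneg h, mul_one]
      · rw [abs_of_neg (not_le.1 h), mul_neg_one]
    rw [h, traceNorm]

/-- **Quantum Pinsker inequality** for full rank states. -/
theorem pinsker {ρ σ : Mat d} (hρ : IsFullRankState ρ) (hσ : IsFullRankState σ) :
    traceNorm (ρ - σ) ^ 2 ≤ 2 * relEnt ρ σ := by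
  obtain ⟨S, hS, hSS, h⟩ := traceNorm_eq_trace_mul (hρ.1.1.sub hσ.1.1)
  have := sq_trace_sub_mul_le hρ.1 hσ.1 hS hSS
  rw [hρ.2, hσ.2] at this
  rw [h]
  simp only [Complex.one_re] at this
  linarith

theorem minEigenvalue_pos [NeZero d] {σ : Mat d} (hσ : σ.PosDef) : 0 < minEigenvalue σ := by
  have hne : (spectrum ℝ σ).Nonempty :=
    ⟨_, hσ.1.eigenvalues_mem_spectrum_real 0⟩
  exact spectrum_pos hσ (hne.csInf_mem Matrix.finite_real_spectrum)

theorem minEigenvalue_le {σ : Mat d} {x : ℝ} (hx : x ∈ spectrum ℝ σ) : minEigenvalue σ ≤ x :=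
  csInf_le Matrix.finite_real_spectrum.bddBelow hx

/-- The eigenvalues of ρ are at most 1, so tr ρ log ρ ≤ 0, and −log σ is at most log(1/σ_min). -/
theorem relEnt_le_log {ρ σ : Mat d} (hρ : IsFullRankState ρ) (hσ : IsFullRankState σ) :
    relEnt ρ σ ≤ Real.log (1 / minEigenvalue σ) := by
  obtain ⟨hρ, tρ⟩ := hρ
  have h1 := trace_eq_sum_left hρ.1 hσ.1.1
  rw [tρ, Complex.one_re] at h1
  suffices relEnt ρ σ ≤ Real.log (1 / minEigenvalue σ) *
      ∑ i, ∑ j, hρ.1.eigenvalues i * ‖eigenMatrix hρ.1 hσ.1.1 1 i j‖ ^ 2 by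
    rwa [← h1, mul_one] at this
  rw [relEnt_eq_sum hρ.1 hσ.1.1, Finset.mul_sum]
  refine Finset.sum_le_sum fun i _ => ?_
  have : NeZero d := ⟨fun h => by subst h; exact i.elim0⟩
  rw [Finset.mul_sum]
  refine Finset.sum_le_sum fun j _ => ?_
  rw [← mul_assoc]
  refine mul_le_mul_of_nonneg_right ?_ (sq_nonneg _)
  set a := hρ.1.eigenvalues with ha
  have hpos : ∀ i, 0 < a i := hρ.eigenvalues_pos
  have hle : a i ≤ 1 := by
    have ht := hρ.1.trace_eq_sum_eigenvalues
    rw [tρ] at ht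
    have ht' : ∑ i, a i = 1 := by
      have := congrArg Complex.re ht
      simpa [Complex.re_sum] using this.symm
    rw [← ht']
    exact Finset.single_le_sum (f := a) (fun j _ => (hpos j).le) (Finset.mem_univ i)
  have hm := minEigenvalue_pos hσ.1
  have hb := minEigenvalue_le (hσ.1.1.eigenvalues_mem_spectrum_real j)
  have l1 : Real.log (a i) ≤ 0 := Real.log_nonpos (hpos i).le hle
  have l2 : Real.log (minEigenvalue σ) ≤ Real.log (hσ.1.1.eigenvalues j) := Real.log_le_log hm hb
  rw [one_div, Real.log_inv]
  nlinarith [hpos i]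

/-! ### The Hilbert–Schmidt dual and the Schrödinger picture. -/

section Dual

theorem trace_conjTranspose_mul_eq_dotProduct (A B : Mat d) :
    (Aᴴ * B).trace = star ⇑((Matrix.stdBasis ℂ (Fin d) (Fin d)).repr A) ⬝ᵥ
      ⇑((Matrix.stdBasis ℂ (Fin d) (Fin d)).repr B) := by
  have h : ∀ (X : Mat d) (i j : Fin d),
      (Matrix.stdBasis ℂ (Fin d) (Fin d)).repr X (i, j) = X i j := fun X i j => by
    simp [Matrix.stdBasis]
  simp only [dotProduct, Fintype.sum_prod_type, Pi.star_apply, h, Matrix.trace,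
    Matrix.diag_apply, Matrix.mul_apply, Matrix.conjTranspose_apply]
  exact Finset.sum_comm

/-- The defining property of the Hilbert-Schmidt dual. -/
theorem trace_hsDual_conjTranspose_mul (L : Superop d) (A B : Mat d) :
    ((hsDual L A)ᴴ * B).trace = (Aᴴ * L B).trace := by
  rw [trace_conjTranspose_mul_eq_dotProduct, trace_conjTranspose_mul_eq_dotProduct,
    ← LinearMap.toMatrix_mulVec_repr (Matrix.stdBasis ℂ (Fin d) (Fin d))
      (Matrix.stdBasis ℂ (Fin d) (Fin d)) L B,
    ← LinearMap.toMatrix_mulVec_repr (Matrix.stdBasis ℂ (Fin d) (Fin d))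
      (Matrix.stdBasis ℂ (Fin d) (Fin d)) (hsDual L) A, hsDual, LinearMap.toMatrix_toLin,
    Matrix.star_mulVec, Matrix.conjTranspose_conjTranspose, Matrix.dotProduct_mulVec]

theorem eq_of_trace_conjTranspose_mul {X Y : Mat d}
    (h : ∀ B : Mat d, (Xᴴ * B).trace = (Yᴴ * B).trace) : X = Y := by
  rw [← sub_eq_zero, ← Matrix.trace_conjTranspose_mul_self_eq_zero_iff,
    Matrix.conjTranspose_sub, sub_mul, Matrix.trace_sub, h, sub_self]

/-- The Schrödinger picture form of a Liouvillian. -/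
theorem IsLiouvillian.exists_hsDual_eq {L : Superop d} (hL : IsLiouvillian L) :
    ∃ (K : Mat d) (k : ℕ) (V : Fin k → Mat d), ∀ ρ : Mat d,
      hsDual L ρ = K * ρ + ρ * Kᴴ + ∑ i, V i * ρ * (V i)ᴴ := by
  obtain ⟨H, k, V, hH, hf⟩ := hL
  set Q : Mat d := ∑ i, (V i)ᴴ * V i with hQ
  have hQH : Qᴴ = Q := by
    simp [hQ, Matrix.conjTranspose_sum]
  -- K collects the Hamiltonian and the anticommutator terms, so that only the positivity preserving
  -- sum over the V i remains.
  set K : Mat d := -(Complex.I • H) - (1 / 2 : ℂ) • Q with hK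
  have hKH : Kᴴ = Complex.I • H - (1 / 2 : ℂ) • Q := by
    rw [hK, Matrix.conjTranspose_sub, Matrix.conjTranspose_neg, Matrix.conjTranspose_smul,
      Matrix.conjTranspose_smul, hH.eq, hQH]
    simp
  have hL' : ∀ f, L f = Kᴴ * f + f * K + ∑ i, (V i)ᴴ * f * V i := by
    intro f
    rw [hf f, Finset.sum_sub_distrib, ← Finset.smul_sum, Finset.sum_add_distrib,
      ← Finset.sum_mul, ← hQ]
    have : ∑ i, f * ((V i)ᴴ * V i) = f * Q := by rw [hQ, Finset.mul_sum]
    rw [this, hKH, hK]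
    simp only [sub_mul, mul_sub, smul_mul_assoc, mul_smul_comm, mul_neg, smul_sub, smul_add]
    abel
  refine ⟨K, k, V, fun ρ => eq_of_trace_conjTranspose_mul fun B => ?_⟩
  rw [trace_hsDual_conjTranspose_mul, hL']
  simp only [Matrix.conjTranspose_add, Matrix.conjTranspose_mul, Matrix.conjTranspose_sum,
    Matrix.conjTranspose_conjTranspose, mul_add, add_mul, Matrix.trace_add, Finset.sum_mul,
    Finset.mul_sum, Matrix.trace_sum]
  congr 1
  · congr 1
    · rw [mul_assoc]
    · rw [mul_assoc K, Matrix.trace_mul_comm K, mul_assoc]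
  · refine Finset.sum_congr rfl fun i _ => ?_
    simp only [mul_assoc]
    rw [Matrix.trace_mul_comm (V i)]
    simp only [mul_assoc]

theorem IsLiouvillian.map_one {L : Superop d} (hL : IsLiouvillian L) : L 1 = 0 := by
  obtain ⟨H, k, V, hH, hf⟩ := hL
  rw [hf]
  simp only [mul_one, one_mul, sub_self, smul_zero, zero_add]
  refine Finset.sum_eq_zero fun i _ => ?_
  rw [← two_smul ℂ, smul_smul]
  norm_num

theorem IsLiouvillian.trace_hsDual {L : Superop d} (hL : IsLiouvillian L) (ρ : Mat d) :
    (hsDual L ρ).trace = 0 := by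
  have h := trace_hsDual_conjTranspose_mul L ρ 1
  rwa [hL.map_one, mul_zero, Matrix.trace_zero, mul_one, Matrix.trace_conjTranspose,
    star_eq_zero] at h

theorem IsLiouvillian.hsDual_isHermitian {L : Superop d} (hL : IsLiouvillian L) {ρ : Mat d}
    (hρ : ρ.IsHermitian) : (hsDual L ρ).IsHermitian := by
  obtain ⟨K, k, V, h⟩ := hL.exists_hsDual_eq
  rw [h, Matrix.IsHermitian]
  simp only [Matrix.conjTranspose_add, Matrix.conjTranspose_mul, Matrix.conjTranspose_sum,
    Matrix.conjTranspose_conjTranspose, hρ.eq, mul_assoc]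
  rw [add_comm (ρ * _)]

end Dual

/-! ### The semigroup: derivatives, invariants and preservation of full rank. -/

section Semigroup

open scoped Matrix.Norms.L2Operator

theorem expSemigroup_zero (K : Superop d) (ρ : Mat d) : expSemigroup K 0 ρ = ρ := by
  simp [expSemigroup, Matrix.toLin_one]

/-- Evaluation at `ρ` of the linear map with a given matrix in the basis of matrix units. -/
def toLinEval (ρ : Mat d) : Matrix (Fin d × Fin d) (Fin d × Fin d) ℂ →L[ℝ] Mat d :=
  LinearMap.toContinuousLinearMap
    { toFun := fun M => Matrix.toLin (Matrix.stdBasis ℂ (Fin d) (Fin d))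
        (Matrix.stdBasis ℂ (Fin d) (Fin d)) M ρ
      map_add' := fun M N => by simp
      map_smul' := fun c M => by
        rw [← Complex.coe_smul, map_smul]
        simp }

theorem expSemigroup_eq (K : Superop d) (t : ℝ) (ρ : Mat d) :
    expSemigroup K t ρ = toLinEval ρ (NormedSpace.exp (t • LinearMap.toMatrix
      (Matrix.stdBasis ℂ (Fin d) (Fin d)) (Matrix.stdBasis ℂ (Fin d) (Fin d)) K)) := by
  rw [expSemigroup, Complex.coe_smul]
  rfl

theorem toLinEval_mul (M N : Matrix (Fin d × Fin d) (Fin d × Fin d) ℂ) (ρ : Mat d) :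
    toLinEval ρ (M * N) = toLinEval (toLinEval ρ N) M := by
  exact LinearMap.congr_fun (Matrix.toLin_mul (Matrix.stdBasis ℂ (Fin d) (Fin d))
    (Matrix.stdBasis ℂ (Fin d) (Fin d)) (Matrix.stdBasis ℂ (Fin d) (Fin d)) M N) ρ

theorem toLinEval_toMatrix (K : Superop d) (ρ : Mat d) :
    toLinEval ρ (LinearMap.toMatrix
      (Matrix.stdBasis ℂ (Fin d) (Fin d)) (Matrix.stdBasis ℂ (Fin d) (Fin d)) K) = K ρ := by
  exact LinearMap.congr_fun (Matrix.toLin_toMatrix (Matrix.stdBasis ℂ (Fin d) (Fin d))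
    (Matrix.stdBasis ℂ (Fin d) (Fin d)) K) ρ

theorem hasDerivAt_expSemigroup (K : Superop d) (ρ : Mat d) (t : ℝ) :
    HasDerivAt (fun t => expSemigroup K t ρ) (K (expSemigroup K t ρ)) t := by
  have h := (toLinEval ρ).hasFDerivAt.comp_hasDerivAt t (hasDerivAt_exp_smul_const'
    (LinearMap.toMatrix (Matrix.stdBasis ℂ (Fin d) (Fin d))
      (Matrix.stdBasis ℂ (Fin d) (Fin d)) K) t)
  rw [toLinEval_mul, ← expSemigroup_eq, toLinEval_toMatrix] at h
  convert! h using 2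

theorem hasDerivAt_expSemigroup' (K : Superop d) (ρ : Mat d) (t : ℝ) :
    HasDerivAt (fun t => expSemigroup K t ρ) (expSemigroup K t (K ρ)) t := by
  have h := (toLinEval ρ).hasFDerivAt.comp_hasDerivAt t (hasDerivAt_exp_smul_const
    (LinearMap.toMatrix (Matrix.stdBasis ℂ (Fin d) (Fin d))
      (Matrix.stdBasis ℂ (Fin d) (Fin d)) K) t)
  rw [toLinEval_mul, toLinEval_toMatrix, ← expSemigroup_eq] at h
  convert! h using 2

theorem expSemigroup_of_map_eq_zero {K : Superop d} {σ : Mat d} (h : K σ = 0) (t : ℝ) :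
    expSemigroup K t σ = σ := by
  have hd : ∀ s, HasDerivAt (fun t => expSemigroup K t σ) 0 s := fun s => by
    have := hasDerivAt_expSemigroup' K σ s
    rwa [h, map_zero] at this
  have := is_const_of_deriv_eq_zero (fun s => (hd s).differentiableAt) (fun s => (hd s).deriv) t 0
  rwa [expSemigroup_zero] at this

theorem toLinEval_pow (K : Superop d) (ρ : Mat d) (t : ℝ) (n : ℕ) :
    toLinEval ρ ((t • LinearMap.toMatrix (Matrix.stdBasis ℂ (Fin d) (Fin d))
      (Matrix.stdBasis ℂ (Fin d) (Fin d)) K) ^ n) = t ^ n • (K ^ n) ρ := by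
  rw [smul_pow, map_smul]
  congr 1
  induction n with
  | zero =>
    rw [pow_zero, pow_zero]
    exact LinearMap.congr_fun (Matrix.toLin_one (Matrix.stdBasis ℂ (Fin d) (Fin d))) ρ
  | succ n ih => rw [pow_succ', toLinEval_mul, ih, toLinEval_toMatrix, pow_succ']; rfl

theorem hasSum_expSemigroup (K : Superop d) (ρ : Mat d) (t : ℝ) :
    HasSum (fun n : ℕ => ((n.factorial : ℝ)⁻¹ * t ^ n) • (K ^ n) ρ) (expSemigroup K t ρ) := by
  have h := (toLinEval ρ).hasSum (NormedSpace.exp_series_hasSum_exp' (𝕂 := ℝ)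
    (t • LinearMap.toMatrix (Matrix.stdBasis ℂ (Fin d) (Fin d))
      (Matrix.stdBasis ℂ (Fin d) (Fin d)) K))
  rw [← expSemigroup_eq] at h
  convert! h using 2 with n
  rw [map_smul, toLinEval_pow, smul_smul]

/-- The exponential series has real coefficients and Hermitian terms, so its sum equals its own
adjoint. -/
theorem expSemigroup_isHermitian {K : Superop d}
    (hK : ∀ ρ : Mat d, ρ.IsHermitian → (K ρ).IsHermitian) {ρ : Mat d} (hρ : ρ.IsHermitian)
    (t : ℝ) : (expSemigroup K t ρ).IsHermitian := by
  have hn : ∀ n : ℕ, ((K ^ n) ρ).IsHermitian := fun n => by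
    induction n with
    | zero => exact hρ
    | succ n ih => rw [pow_succ']; exact hK _ ih
  have h := hasSum_expSemigroup K ρ t
  have h2 := h.star
  refine h2.unique ?_
  convert! h using 2 with n
  rw [star_smul, Matrix.star_eq_conjTranspose, (hn n).eq, star_trivial]

/-- The real linear functional `X ↦ Re tr (A X)`. -/
def reTraceMul (A : Mat d) : Mat d →L[ℝ] ℝ :=
  LinearMap.toContinuousLinearMap
    { toFun := fun X => (A * X).trace.re
      map_add' := fun X Y => by simp [mul_add]
      map_smul' := fun c X => by simp }

@[simp]
theorem reTraceMul_apply (A X : Mat d) : reTraceMul A X = (A * X).trace.re := rfl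

theorem expSemigroup_trace {K : Superop d} (hK : ∀ ρ : Mat d, (K ρ).trace = 0) (ρ : Mat d)
    (t : ℝ) : (expSemigroup K t ρ).trace = ρ.trace := by
  let ℓ : Mat d →L[ℝ] ℂ := LinearMap.toContinuousLinearMap (Matrix.traceLinearMap (Fin d) ℝ ℂ)
  have hd : ∀ s, HasDerivAt (fun t => ℓ (expSemigroup K t ρ)) 0 s := fun s => by
    have := ℓ.hasFDerivAt.comp_hasDerivAt s (hasDerivAt_expSemigroup K ρ s)
    have e : ℓ (K (expSemigroup K s ρ)) = 0 := hK _
    rwa [e] at this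
  have := is_const_of_deriv_eq_zero (fun s => (hd s).differentiableAt) (fun s => (hd s).deriv) t 0
  rw [expSemigroup_zero] at this
  exact this

/-- The quadratic form of a matrix at a vector, as a functional of the matrix. -/
def quadForm (v : Fin d → ℂ) : Mat d →L[ℝ] ℝ :=
  LinearMap.toContinuousLinearMap
    { toFun := fun X => (star v ⬝ᵥ (X *ᵥ v)).re
      map_add' := fun X Y => by simp [Matrix.add_mulVec]
      map_smul' := fun c X => by simp [Matrix.smul_mulVec] }

theorem posDef_of_quadForm_pos {A : Mat d} (hA : A.IsHermitian)
    (h : ∀ v, v ≠ 0 → 0 < quadForm v A) : A.PosDef := by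
  refine Matrix.PosDef.of_dotProduct_mulVec_pos hA fun v hv => ?_
  rw [Complex.pos_iff]
  exact ⟨h v hv, (hA.im_star_dotProduct_mulVec_self v).symm⟩

/-- A Liouvillian evolution maps full rank states to full rank states. -/
theorem expSemigroup_posDef {L : Superop d} (hL : IsLiouvillian L) {ρ : Mat d}
    (hρ : ρ.PosDef) {t : ℝ} (ht : 0 ≤ t) : (expSemigroup (hsDual L) t ρ).PosDef := by
  obtain ⟨K, k, V, hK⟩ := hL.exists_hsDual_eq
  set y : ℝ → Mat d := fun t => expSemigroup (hsDual L) t ρ with hy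
  have yH : ∀ t, (y t).IsHermitian :=
    fun t => expSemigroup_isHermitian (fun _ h => hL.hsDual_isHermitian h) hρ.1 t
  have yd : ∀ t, HasDerivAt y (hsDual L (y t)) t := hasDerivAt_expSemigroup _ ρ
  -- Interaction picture: conjugation by e^{-tK} cancels the K terms, so the derivative of g is
  -- positive semidefinite as long as y is.
  set P : ℝ → Mat d := fun t => NormedSpace.exp (t • (-K)) with hP
  have Pd : ∀ t, HasDerivAt P (P t * (-K)) t := hasDerivAt_exp_smul_const (-K)
  have Pu : ∀ t, IsUnit (P t) := fun t => Matrix.isUnit_exp _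
  set g : ℝ → Mat d := fun t => P t * y t * (P t)ᴴ with hg
  have gd : ∀ t, HasDerivAt g (P t * (∑ i, V i * y t * (V i)ᴴ) * (P t)ᴴ) t := by
    intro t
    have h := ((Pd t).mul (yd t)).mul (Pd t).star
    convert! h using 1
    rw [hK (y t), Matrix.star_eq_conjTranspose, Matrix.star_eq_conjTranspose,
      Matrix.conjTranspose_mul, Matrix.conjTranspose_neg, Pi.mul_apply]
    noncomm_ring
  -- Up to time s the quadratic forms of g cannot decrease, so g stays above its initial value ρ;
  -- conjugating back by the invertible P s gives y s.
  have hstep : ∀ s, 0 ≤ s → (∀ τ ∈ Set.Ico 0 s, (y τ).PosDef) → (y s).PosDef := by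
    intro s hs hτ
    have gs : (g s).PosDef := by
      refine posDef_of_quadForm_pos (Matrix.isHermitian_mul_mul_conjTranspose _ (yH s)) ?_
      intro v hv
      have φd : ∀ t, HasDerivAt (fun t => quadForm v (g t))
          (quadForm v (P t * (∑ i, V i * y t * (V i)ᴴ) * (P t)ᴴ)) t :=
        fun t => (quadForm v).hasFDerivAt.comp_hasDerivAt t (gd t)
      have hm : MonotoneOn (fun t => quadForm v (g t)) (Set.Icc 0 s) := by
        refine monotoneOn_of_deriv_nonneg (convex_Icc 0 s)
          (fun x _ => (φd x).continuousAt.continuousWithinAt)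
          (fun x _ => (φd x).differentiableAt.differentiableWithinAt) fun x hx => ?_
        rw [interior_Icc] at hx
        rw [(φd x).deriv]
        have hp : (P x * (∑ i, V i * y x * (V i)ᴴ) * (P x)ᴴ).PosSemidef := by
          refine Matrix.PosSemidef.mul_mul_conjTranspose_same ?_ _
          refine Matrix.posSemidef_sum _ fun i _ => ?_
          exact (hτ x ⟨hx.1.le, hx.2⟩).posSemidef.mul_mul_conjTranspose_same _
        exact hp.re_dotProduct_nonneg v
      have h0 : g 0 = ρ := by
        simp [hg, hP, hy, expSemigroup_zero]
      have h1 := hm ⟨le_rfl, hs⟩ ⟨hs, le_rfl⟩ hs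
      refine lt_of_lt_of_le ?_ h1
      simp only [h0]
      exact hρ.re_dotProduct_pos hv
    exact (Matrix.IsUnit.posDef_star_right_conjugate_iff (Pu s)).1 gs
  by_contra hcon
  -- At the infimum of the bad times y is still positive definite by `hstep`; by openness it stays
  -- so a little longer, a contradiction.
  let S : Set ℝ := {t | 0 ≤ t ∧ ¬ (y t).PosDef}
  have hSne : S.Nonempty := ⟨t, ht, hcon⟩
  have hSb : BddBelow S := ⟨0, fun _ h => h.1⟩
  have hs0 : 0 ≤ sInf S := le_csInf hSne fun _ h => h.1
  have hs : (y (sInf S)).PosDef := hstep _ hs0 fun τ hτ => by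
    by_contra hn
    exact absurd (csInf_le hSb (show τ ∈ S from ⟨hτ.1, hn⟩)) (not_le.2 hτ.2)
  have hev := eventually_posDef (yd (sInf S)).continuousAt hs yH
  obtain ⟨ε, hε, hball⟩ := Metric.eventually_nhds_iff.1 hev
  obtain ⟨τ, hτS, hτ⟩ := exists_lt_of_csInf_lt hSne (lt_add_of_pos_right (sInf S) hε)
  refine hτS.2 (hball ?_)
  have := csInf_le hSb hτS
  rw [Real.dist_eq, abs_of_nonneg (by linarith)]
  linarith

end Semigroup

/-! ### Entropy production and Grönwall's inequality. -/

section Derivative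

open scoped Matrix.Norms.L2Operator
open Filter Topology

theorem relEnt_add_relEnt (A B : Mat d) :
    relEnt A B + relEnt B A = ((A - B) * (mlog A - mlog B)).trace.re := by
  simp only [relEnt, mul_sub, sub_mul, Matrix.trace_sub, Complex.sub_re]
  ring

/-- No derivative of the matrix logarithm is needed. Write D(y_s‖σ) as a function linear in y_s plus
D(y_s‖y_t). By Klein the latter lies between 0 and D(y_s‖y_t) + D(y_t‖y_s) = tr((y_s − y_t)(log y_s
− log y_t)), which is o(s − t) by continuity of the logarithm. -/
theorem hasDerivAt_relEnt {y : ℝ → Mat d} {y' : Mat d} {t : ℝ} (σ : Mat d)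
    (hy : HasDerivAt y y' t) (hp : ∀ᶠ s in 𝓝 t, (y s).PosDef)
    (htr : ∀ s, (y s).trace = (y t).trace) :
    HasDerivAt (fun s => relEnt (y s) σ) ((y' * (mlog (y t) - mlog σ)).trace.re) t := by
  have hpt : (y t).PosDef := hp.self_of_nhds
  have hlin : HasDerivAt (fun s => (y s * (mlog (y t) - mlog σ)).trace.re)
      ((y' * (mlog (y t) - mlog σ)).trace.re) t := by
    have := (reTraceMul (mlog (y t) - mlog σ)).hasFDerivAt.comp_hasDerivAt t hy
    convert! this using 1
    · ext s
      rw [Matrix.trace_mul_comm]; rfl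
    · rw [Matrix.trace_mul_comm]; rfl
  have hzero : relEnt (y t) (y t) = 0 := by simp [relEnt]
  have hrem : HasDerivAt (fun s => relEnt (y s) (y t)) 0 t := by
    rw [hasDerivAt_iff_tendsto_slope]
    have hlog : Tendsto (fun s => mlog (y s) - mlog (y t)) (𝓝[≠] t) (𝓝 0) := by
      have := (tendsto_mlog hy.continuousAt hpt hp).sub_const (mlog (y t))
      rw [sub_self] at this
      exact this.mono_left nhdsWithin_le_nhds
    have hprod : Tendsto
        (fun s => reTraceMul 1 (slope y t s * (mlog (y s) - mlog (y t)))) (𝓝[≠] t) (𝓝 0) := by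
      have := ((reTraceMul (1 : Mat d)).continuous.tendsto _).comp
        ((hasDerivAt_iff_tendsto_slope.1 hy).mul hlog)
      rwa [mul_zero, map_zero] at this
    refine squeeze_zero_norm' ?_ (hprod.norm.trans (by rw [norm_zero]))
    filter_upwards [hp.filter_mono nhdsWithin_le_nhds] with s hps
    have k1 : 0 ≤ relEnt (y s) (y t) := by
      have := klein hps hpt
      rwa [htr s, sub_self] at this
    have k2 : 0 ≤ relEnt (y t) (y s) := by
      have := klein hpt hps
      rwa [htr s, sub_self] at this
    have k3 := relEnt_add_relEnt (y s) (y t)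
    rw [slope, vsub_eq_sub, hzero, sub_zero, norm_smul, slope, vsub_eq_sub, smul_mul_assoc,
      map_smul, norm_smul, reTraceMul_apply, one_mul, ← k3, Real.norm_of_nonneg k1,
      Real.norm_of_nonneg (add_nonneg k1 k2)]
    exact mul_le_mul_of_nonneg_left (by linarith) (norm_nonneg _)
  convert! hlin.add hrem using 1
  · ext s
    simp only [relEnt, Pi.add_apply, mul_sub, Matrix.trace_sub, Complex.sub_re]
    ring
  · rw [add_zero]

theorem le_mul_exp_of_hasDerivAt {F F' : ℝ → ℝ} {k : ℝ}
    (hF : ∀ t, 0 ≤ t → HasDerivAt F (F' t) t) (hle : ∀ t, 0 ≤ t → F' t ≤ -k * F t)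
    {t : ℝ} (ht : 0 ≤ t) : F t ≤ F 0 * Real.exp (-(k * t)) := by
  have hd : ∀ s, 0 ≤ s → HasDerivAt (fun s => F s * Real.exp (k * s))
      (F' s * Real.exp (k * s) + F s * (Real.exp (k * s) * (k * 1))) s := fun s hs =>
    (hF s hs).mul ((hasDerivAt_id s).const_mul k).exp
  have : AntitoneOn (fun s => F s * Real.exp (k * s)) (Set.Icc 0 t) := by
    refine antitoneOn_of_deriv_nonpos (convex_Icc 0 t)
      (fun x hx => (hd x hx.1).continuousAt.continuousWithinAt) (fun x hx => ?_) fun x hx => ?_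
    · rw [interior_Icc] at hx
      exact (hd x hx.1.le).differentiableAt.differentiableWithinAt
    · rw [interior_Icc] at hx
      rw [(hd x hx.1.le).deriv]
      nlinarith [hle x hx.1.le, Real.exp_pos (k * x)]
  have h := this ⟨le_rfl, ht⟩ ⟨ht, le_rfl⟩ ht
  simp only [mul_zero, Real.exp_zero, mul_one] at h
  rwa [Real.exp_neg, ← div_eq_mul_inv, le_div_iff₀ (Real.exp_pos _)]

end Derivative

/-! ### From regularity of L at large p to the L_1 form of its dual. -/

section Regularity

open scoped Matrix.Norms.L2Operator
open Filter Topology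

theorem re_trace_hsDual_mul (L : Superop d) {A B : Mat d} (hA : A.IsHermitian)
    (hB : B.IsHermitian) : (hsDual L A * B).trace.re = (A * L B).trace.re := by
  have h := trace_hsDual_conjTranspose_mul L A B
  rw [hA.eq] at h
  have h2 : star (hsDual L A * B).trace = ((hsDual L A)ᴴ * B).trace := by
    rw [← Matrix.trace_conjTranspose, Matrix.conjTranspose_mul, hB.eq, Matrix.trace_mul_comm]
  rw [← h, ← h2]
  simp

theorem dirichletForm_two {σ : Mat d} (hσ : σ.PosDef) (K : Superop d) {f : Mat d}
    (hf : f.PosDef) : dirichletForm σ K 2 f = -wInner σ f (K f) := by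
  rw [dirichletForm, if_neg (by norm_num), show (2 : ℝ) / (2 - 1) = 2 by norm_num,
    powOp_self hσ two_ne_zero hf]
  norm_num

/-- Both forms are real parts of the same pairing of f with L, read from its two sides. This carries
the log-Sobolev hypothesis on the dual over to L. -/
theorem dirichletForm_two_relDual {σ : Mat d} (hσ : σ.PosDef) (L : Superop d) {f : Mat d}
    (hf : f.PosDef) : dirichletForm σ (relDual σ L) 2 f = dirichletForm σ L 2 f := by
  rw [dirichletForm_two hσ _ hf, dirichletForm_two hσ _ hf, wInner, wInner, trace_weight_mul]
  have : weight σ 1 (relDual σ L f) = hsDual L (weight σ 1 f) := by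
    rw [relDual, LinearMap.comp_apply, LinearMap.comp_apply, weight_weight hσ, add_neg_cancel,
      weight_zero hσ]
  rw [this, Matrix.trace_mul_comm, re_trace_hsDual_mul L (weight_posDef hσ 1 hf).1 hf.1]

theorem powOp_weight_neg_one {σ ρ : Mat d} (hσ : σ.PosDef) (hρ : ρ.PosDef) (p q : ℝ) :
    powOp σ p q (weight σ (-1) ρ) =
      weight σ (-(1 / p)) (mpow (weight σ (1 / q - 1) ρ) (q / p)) := by
  rw [powOp_eq hσ p q (weight_posDef hσ _ hρ), weight_weight hσ, sub_eq_add_neg]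

/-- Here X = ρ^{1/2}: its logarithm contributes the factor 1/2, and the norm is 1, so the last term
vanishes. -/
theorem ent2_powOp {σ ρ : Mat d} (hσ : σ.PosDef) (hρ : IsFullRankState ρ) :
    ent2 σ (powOp σ 2 1 (weight σ (-1) ρ)) = 1 / 2 * relEnt ρ σ := by
  have hX : weight σ (1 / 2) (powOp σ 2 1 (weight σ (-1) ρ)) = mpow ρ (1 / 2) := by
    rw [powOp_weight_neg_one hσ hρ.1, weight_weight hσ, add_neg_cancel, weight_zero hσ, one_div_one,
      sub_self, weight_zero hσ]
  have hN : wNorm σ 2 (powOp σ 2 1 (weight σ (-1) ρ)) = 1 := by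
    rw [wNorm, hX, absPow_eq_mpow (mpow_posDef hρ.1 _), mpow_mpow hρ.1,
      show (1 / 2 * 2 : ℝ) = 1 by norm_num, mpow_one hρ.1, hρ.2]
    simp
  rw [ent2, hX, hN, sq (mpow ρ _), mpow_mul_mpow hρ.1, show (1 / 2 + 1 / 2 : ℝ) = 1 by norm_num,
    mpow_one hρ.1, mlog_mpow hρ.1, relEnt, mul_sub, Matrix.trace_sub, Complex.sub_re]
  simp
  ring

theorem tendsto_mpow {X : Type*} {l : Filter X} {a : X → Mat d} {A : Mat d} {r : X → ℝ} {s : ℝ}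
    (ha : Tendsto a l (𝓝 A)) (hA : A.PosDef) (hp : ∀ x, (a x).PosDef) (hr : Tendsto r l (𝓝 s)) :
    Tendsto (fun x => mpow (a x) (r x)) l (𝓝 (mpow A s)) := by
  rw [mpow_eq_exp hA]
  simp_rw [fun x => mpow_eq_exp (hp x) (r x)]
  exact ((NormedSpace.exp_analytic (𝕂 := ℝ) _).continuousAt.tendsto).comp
    (hr.smul (tendsto_mlog ha hA (Eventually.of_forall hp)))

theorem hasDerivAt_mpow_exponent {σ : Mat d} (hσ : σ.PosDef) (a : ℝ) :
    HasDerivAt (fun s : ℝ => mpow σ (s * a)) (a • mlog σ) 0 := by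
  have h := hasDerivAt_exp_smul_const (𝕂 := ℝ) (a • mlog σ : Mat d) (0 : ℝ)
  rw [zero_smul, NormedSpace.exp_zero, one_mul] at h
  convert! h using 1
  ext1 s
  rw [mpow_eq_exp hσ, smul_smul]

/-- Since the exponent vanishes at 0, convergence of the base suffices: the difference quotient of
e(s) log X(s) is (e(s)/s) log X(s). -/
theorem hasDerivAt_mpow_of_tendsto {X : ℝ → Mat d} {ρ : Mat d} (hX : ∀ s, (X s).PosDef)
    (hρ : ρ.PosDef) (hlim : Tendsto X (𝓝[≠] 0) (𝓝 ρ)) {e : ℝ → ℝ} (he0 : e 0 = 0)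
    (he : HasDerivAt e 1 0) :
    HasDerivAt (fun s => mpow (X s) (e s)) (mlog ρ) 0 := by
  have hZ : HasDerivAt (fun s => e s • mlog (X s)) (mlog ρ) 0 := by
    rw [hasDerivAt_iff_tendsto_slope]
    have h := (hasDerivAt_iff_tendsto_slope.1 he).smul
      (tendsto_mlog hlim hρ (Eventually.of_forall hX))
    rw [one_smul] at h
    convert! h using 2 with s
    simp [slope, he0, smul_smul]
  have hexp : HasFDerivAt (NormedSpace.exp : Mat d → Mat d)
      (1 : Mat d →L[ℝ] Mat d) (e 0 • mlog (X 0)) := by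
    rw [he0, zero_smul]
    exact hasFDerivAt_exp_zero
  have h := hexp.comp_hasDerivAt (0 : ℝ) hZ
  convert! h using 1
  ext1 s
  exact mpow_eq_exp (hX s) (e s)

/-- If `L` satisfies a regularity estimate for the exponents `p = 1 / s` with `s` close to `0`,
then the `L_1` Dirichlet form of the dual generator dominates the `L_2` Dirichlet form. -/
theorem regularity_limit {L : Superop d} (hL : IsLiouvillian L) {σ : Mat d} (hσ : σ.PosDef)
    {r : ℝ → ℝ} {c : ℝ} (hr : Tendsto (fun s => s⁻¹ * r s) (𝓝[>] 0) (𝓝 c))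
    (hreg : ∀ h : Mat d, h.PosDef → ∀ s : ℝ, 0 < s → s ≤ 1 / 2 →
      r s * dirichletForm σ L 2 (powOp σ 2 (1 / s) h) ≤ dirichletForm σ L (1 / s) h)
    {ρ : Mat d} (hρ : ρ.PosDef) :
    c * dirichletForm σ L 2 (powOp σ 2 1 (weight σ (-1) ρ)) ≤
      -(1 / 2) * (hsDual L ρ * (mlog ρ - mlog σ)).trace.re := by
  set g := weight σ (-1) ρ with hg
  have gp : g.PosDef := weight_posDef hσ _ hρ
  set W : ℝ → Mat d := fun s => mpow σ (s * (-(1 / 2))) with hW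
  have Wd : HasDerivAt W (-(1 / 2 : ℝ) • mlog σ) 0 := hasDerivAt_mpow_exponent hσ _
  have W0 : W 0 = 1 := by simp [hW, mpow_zero hσ]
  have hwt : ∀ s f, weight σ (-s) f = W s * f * W s := by
    intro s f
    rw [weight_apply, hW]
    congr 3 <;> ring_nf
  set X : ℝ → Mat d := fun s => weight σ (-s) ρ with hX
  have Xp : ∀ s, (X s).PosDef := fun s => weight_posDef hσ _ hρ
  have X0 : X 0 = ρ := by simp [hX, weight_zero hσ]
  have Xlim : Tendsto X (𝓝 0) (𝓝 ρ) := by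
    have : X = fun s => W s * ρ * W s := funext fun s => hwt s ρ
    have hc : ContinuousAt X 0 := by
      rw [this]
      exact (Wd.continuousAt.mul continuousAt_const).mul Wd.continuousAt
    have h := hc.tendsto
    rwa [X0] at h
  -- With p = 1/s and q = 1/(1 − s) this is q/p, the exponent in I_{p,q}; also X s = Γ_σ^{1/q}(g),
  -- so the h defined below is I_{p,q}(g).
  have ed : HasDerivAt (fun s : ℝ => s / (1 - s)) 1 0 := by
    have := (hasDerivAt_id (0 : ℝ)).div ((hasDerivAt_id (0 : ℝ)).const_sub 1) (by simp)
    convert! this using 1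
    simp
  set N : ℝ → Mat d := fun s => mpow (X s) (s / (1 - s)) with hN
  have Nd : HasDerivAt N (mlog ρ) 0 :=
    hasDerivAt_mpow_of_tendsto Xp hρ (Xlim.mono_left nhdsWithin_le_nhds) (by simp) ed
  have N0 : N 0 = 1 := by simp [hN, mpow_zero (Xp 0)]
  set h : ℝ → Mat d := fun s => W s * N s * W s with hh
  have h0 : h 0 = 1 := by simp [hh, W0, N0]
  have hd : HasDerivAt h (mlog ρ - mlog σ) 0 := by
    have := (Wd.mul Nd).mul Wd
    convert! this using 1
    simp only [W0, N0, Pi.mul_apply, mul_one, one_mul]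
    module
  have hslope : Tendsto (fun s => s⁻¹ * (hsDual L ρ * h s).trace.re) (𝓝[>] 0)
      (𝓝 (hsDual L ρ * (mlog ρ - mlog σ)).trace.re) := by
    have h1 := ((reTraceMul (hsDual L ρ)).continuous.tendsto _).comp
      ((hasDerivAt_iff_tendsto_slope.1 hd).mono_left
        (nhdsWithin_mono (0 : ℝ) fun x hx => (ne_of_gt hx : x ≠ 0)))
    refine h1.congr fun s => ?_
    -- Trace preservation removes the zeroth order term, which makes division by s harmless.
    have e : (hsDual L ρ * h 0).trace.re = 0 := by
      rw [h0, mul_one, hL.trace_hsDual, Complex.zero_re]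
    rw [Function.comp_apply, slope, vsub_eq_sub, map_smul, map_sub, reTraceMul_apply,
      reTraceMul_apply, e]
    simp
  set Y : ℝ → Mat d := fun s => powOp σ 2 (1 / (1 - s)) g with hY
  have Yp : ∀ s, (Y s).PosDef := fun s => powOp_posDef hσ _ _ gp
  have hqlim : Tendsto (fun s : ℝ => 1 / (1 - s)) (𝓝 0) (𝓝 1) := by
    have : ContinuousAt (fun s : ℝ => 1 / (1 - s)) 0 :=
      continuousAt_const.div (continuousAt_const.sub continuousAt_id) (by simp)
    simpa using this.tendsto
  have Ylim : Tendsto Y (𝓝 0) (𝓝 (powOp σ 2 1 g)) := by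
    have e : ∀ s, Y s = weight σ (-(1 / 2)) (mpow (X s) (1 / (1 - s) / 2)) := by
      intro s
      rw [hY, hg]
      simp only
      rw [powOp_weight_neg_one hσ hρ, one_div_one_div, sub_sub_cancel_left]
    have e0 : powOp σ 2 1 g = weight σ (-(1 / 2)) (mpow ρ (1 / 2)) := by
      rw [hg, powOp_weight_neg_one hσ hρ, one_div_one, sub_self, weight_zero hσ]
    rw [e0, funext e]
    exact ((weight σ (-(1 / 2))).continuous_of_finiteDimensional.tendsto _).comp
      (tendsto_mpow Xlim hρ Xp (hqlim.div_const 2))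
  have Elim : Tendsto (fun s => dirichletForm σ L 2 (Y s)) (𝓝 0)
      (𝓝 (dirichletForm σ L 2 (powOp σ 2 1 g))) := by
    rw [dirichletForm_two hσ L (powOp_posDef hσ _ _ gp)]
    simp_rw [fun s => dirichletForm_two hσ L (Yp s), wInner]
    have h1 := ((weight σ 1).continuous_of_finiteDimensional.tendsto _).comp Ylim
    have h2 := (L.continuous_of_finiteDimensional.tendsto _).comp Ylim
    have h3 := (((reTraceMul (1 : Mat d)).continuous.tendsto _).comp (h1.mul h2)).neg
    simpa only [Function.comp_def, reTraceMul_apply, one_mul] using h3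
  -- This is the regularity estimate at h s divided by s. The power operators compose, so I_{2,p}(h
  -- s) = Y s and I_{q,p}(h s) = g.
  have key : ∀ᶠ s : ℝ in 𝓝[>] 0, s⁻¹ * r s * dirichletForm σ L 2 (Y s) ≤
      -(1 / 2) * (1 / (1 - s)) * (s⁻¹ * (hsDual L ρ * h s).trace.re) := by
    filter_upwards [Ioc_mem_nhdsGT (show (0 : ℝ) < 1 / 2 by norm_num)] with s hs
    have hs0 : 0 < s := hs.1
    have hs1 : 0 < 1 - s := by linarith [hs.2]
    have hq : 1 / s / (1 / s - 1) = 1 / (1 - s) := by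
      have : s ≠ 0 := hs0.ne'
      field_simp
    have hh' : powOp σ (1 / s) (1 / (1 - s)) g = h s := by
      rw [hg, powOp_weight_neg_one hσ hρ, one_div_one_div, one_div_one_div, sub_sub_cancel_left,
        hwt, hh, hN, show 1 / (1 - s) / (1 / s) = s / (1 - s) by field_simp]
    have hp : (h s).PosDef := hh' ▸ powOp_posDef hσ _ _ gp
    have hne : (1 / s : ℝ) ≠ 1 := by
      rw [Ne, div_eq_one_iff_eq hs0.ne']; linarith
    have h1 := hreg (h s) hp s hs0 hs.2
    have e1 : powOp σ 2 (1 / s) (h s) = Y s := by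
      rw [← hh', powOp_powOp hσ _ (by positivity) _ gp]
    have e2 : dirichletForm σ L (1 / s) (h s) =
        -(1 / 2) * (1 / (1 - s)) * (hsDual L ρ * h s).trace.re := by
      rw [dirichletForm, if_neg hne, hq]
      have : powOp σ (1 / (1 - s)) (1 / s) (h s) = g := by
        rw [← hh', powOp_powOp hσ _ (by positivity) _ gp, powOp_self hσ (by positivity) gp]
      rw [this, wInner, hg, weight_weight hσ, add_neg_cancel, weight_zero hσ,
        re_trace_hsDual_mul L hρ.1 hp.1]
      congr 1
      have : s ≠ 0 := hs0.ne'
      have : 1 / s - 1 ≠ 0 := sub_ne_zero.2 hne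
      rw [← hq]
      field_simp
    rw [e1, e2] at h1
    have := mul_le_mul_of_nonneg_left h1 (inv_nonneg.2 hs0.le)
    calc _ = s⁻¹ * (r s * dirichletForm σ L 2 (Y s)) := by ring
      _ ≤ _ := this
      _ = _ := by ring
  have lhs := hr.mul (Elim.mono_left nhdsWithin_le_nhds)
  have rhs := ((hqlim.const_mul (-(1 / 2) : ℝ)).mono_left
    (nhdsWithin_le_nhds (s := Set.Ioi 0))).mul hslope
  rw [mul_one] at rhs
  exact le_of_tendsto_of_tendsto lhs rhs key

end Regularity

/-! ### From entropy decay to trace norm convergence. -/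

section Mixing

open scoped Matrix.Norms.L2Operator
open Filter Topology

theorem traceNorm_smul {c : ℝ} (hc : 0 ≤ c) (A : Mat d) :
    traceNorm (c • A) = c * traceNorm A := by
  have hB : (Aᴴ * A).IsHermitian := Matrix.isHermitian_conjTranspose_mul_self A
  have h1 : (c • A)ᴴ * (c • A) = cfc (fun x : ℝ => c ^ 2 * x) (Aᴴ * A) := by
    rw [cfc_const_mul (c ^ 2) (fun x : ℝ => x) (Aᴴ * A), cfc_id_eq hB,
      Matrix.conjTranspose_smul, star_trivial, smul_mul_smul_comm, sq]
  have h2 : cfc (fun x : ℝ => Real.sqrt (c ^ 2 * x)) (Aᴴ * A) = c • cfc Real.sqrt (Aᴴ * A) := by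
    rw [← cfc_const_mul c Real.sqrt (Aᴴ * A)]
    refine cfc_congr fun x _ => ?_
    rw [Real.sqrt_mul (sq_nonneg c), Real.sqrt_sq hc]
  rw [traceNorm, h1, cfc_cfc _ _ hB, h2, Matrix.trace_smul, traceNorm]
  simp

theorem IsFullRankState.expSemigroup {L : Superop d} (hL : IsLiouvillian L) {ρ : Mat d}
    (hρ : IsFullRankState ρ) {t : ℝ} (ht : 0 ≤ t) :
    IsFullRankState (expSemigroup (hsDual L) t ρ) :=
  ⟨expSemigroup_posDef hL hρ.1 ht, (expSemigroup_trace hL.trace_hsDual ρ t).trans hρ.2⟩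

/-- If the entropy production dominates the relative entropy, then the trace distance to the
stationary state decays exponentially from every full rank initial state. -/
theorem traceNorm_le_of_entropy_production {L : Superop d} (hL : IsLiouvillian L) {σ : Mat d}
    (hσ : IsFullRankState σ) {k : ℝ}
    (hprod : ∀ ρ : Mat d, IsFullRankState ρ →
      (hsDual L ρ * (mlog ρ - mlog σ)).trace.re ≤ -k * relEnt ρ σ)
    {ρ : Mat d} (hρ : IsFullRankState ρ) {t : ℝ} (ht : 0 ≤ t) :
    traceNorm (expSemigroup (hsDual L) t ρ - σ) ≤
      Real.sqrt (2 * Real.log (1 / minEigenvalue σ)) * Real.exp (-(k * t) / 2) := by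
  have hy := fun t (ht : 0 ≤ t) => hρ.expSemigroup hL ht
  have hH : ∀ t, (expSemigroup (hsDual L) t ρ).IsHermitian :=
    fun t => expSemigroup_isHermitian (fun _ h => hL.hsDual_isHermitian h) hρ.1.1 t
  have hdecay := le_mul_exp_of_hasDerivAt (k := k)
    (fun s hs => hasDerivAt_relEnt σ (hasDerivAt_expSemigroup (hsDual L) ρ s)
      (eventually_posDef (hasDerivAt_expSemigroup (hsDual L) ρ s).continuousAt (hy s hs).1 hH)
      (fun τ => by
        rw [expSemigroup_trace hL.trace_hsDual, expSemigroup_trace hL.trace_hsDual]))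
    (fun s hs => hprod _ (hy s hs)) ht
  rw [expSemigroup_zero] at hdecay
  have hpin := pinsker (hy t ht) hσ
  have h0 := relEnt_le_log hρ hσ
  have hexp : Real.exp (-(k * t)) = Real.exp (-(k * t) / 2) ^ 2 := by
    rw [← Real.exp_nat_mul]; congr 1; push_cast; ring
  have h1 : traceNorm (expSemigroup (hsDual L) t ρ - σ) ^ 2 ≤
      2 * Real.log (1 / minEigenvalue σ) * Real.exp (-(k * t) / 2) ^ 2 := by
    rw [← hexp]
    have := mul_le_mul_of_nonneg_right h0 (Real.exp_pos (-(k * t))).le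
    linarith
  refine (Real.le_sqrt_of_sq_le h1).trans ?_
  rw [Real.sqrt_mul' _ (sq_nonneg _), Real.sqrt_sq (Real.exp_pos _).le]

/-- A bound on the trace distance to a stationary state extends from full rank initial states to
all initial states. -/
theorem traceNorm_le_of_forall_fullRank {K : Superop d} {σ : Mat d} (hσ : IsFullRankState σ)
    (hK : K σ = 0) {t C : ℝ} (hC : 0 ≤ C)
    (h : ∀ ρ : Mat d, IsFullRankState ρ → traceNorm (expSemigroup K t ρ - σ) ≤ C)
    {ρ : Mat d} (hρ : IsState ρ) : traceNorm (expSemigroup K t ρ - σ) ≤ C := by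
  set a := traceNorm (expSemigroup K t ρ - σ) with ha
  have key : ∀ ε : ℝ, 0 < ε → ε ≤ 1 → (1 - ε) * a ≤ C := by
    intro ε h0 h1
    -- As σ is stationary, mixing it in gives full rank and merely scales the distance to σ by 1 −
    -- ε.
    have hs : IsFullRankState ((1 - ε) • ρ + ε • σ) := by
      refine ⟨Matrix.PosDef.posSemidef_add (hρ.1.smul (sub_nonneg.2 h1)) (hσ.1.smul h0), ?_⟩
      rw [Matrix.trace_add, Matrix.trace_smul, Matrix.trace_smul, hρ.2, hσ.2, ← add_smul]
      simp
    have h2 := h _ hs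
    have e : expSemigroup K t ((1 - ε) • ρ + ε • σ) - σ = (1 - ε) • (expSemigroup K t ρ - σ) := by
      rw [map_add, LinearMap.map_smul_of_tower, LinearMap.map_smul_of_tower,
        expSemigroup_of_map_eq_zero hK]
      module
    rwa [e, traceNorm_smul (sub_nonneg.2 h1)] at h2
  by_contra hcon
  push Not at hcon
  have ha0 : 0 < a := hC.trans_lt hcon
  -- For this ε, (1 − ε)a is the midpoint of a and C, which exceeds C.
  have := key ((a - C) / (2 * a)) (div_pos (by linarith) (by linarith))
    ((div_le_one (by linarith)).2 (by linarith))
  rw [sub_mul, div_mul_eq_mul_div, mul_comm 2 a, mul_comm (a - C) a,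
    mul_div_mul_left _ _ ha0.ne'] at this
  linarith

/-- Convergence from the logarithmic Sobolev inequality, given regularity estimates with
coefficients `r s ∼ c s` for the exponents `p = 1 / s`. -/
theorem traceNorm_le_of_regularity {L : Superop d} (hL : IsLiouvillian L) {σ : Mat d}
    (hσ : IsPrimitive L σ) {α : ℝ} (hLS : LogSobolev2 σ (relDual σ L) α)
    {r : ℝ → ℝ} {c : ℝ} (hc : 0 ≤ c) (hr : Tendsto (fun s => s⁻¹ * r s) (𝓝[>] 0) (𝓝 c))
    (hreg : ∀ h : Mat d, h.PosDef → ∀ s : ℝ, 0 < s → s ≤ 1 / 2 →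
      r s * dirichletForm σ L 2 (powOp σ 2 (1 / s) h) ≤ dirichletForm σ L (1 / s) h)
    {ρ : Mat d} (hρ : IsState ρ) {t : ℝ} (ht : 0 ≤ t) :
    traceNorm (expSemigroup (hsDual L) t ρ - σ) ≤
      Real.sqrt (2 * Real.log (1 / minEigenvalue σ)) * Real.exp (-(c * α * t) / 2) := by
  refine traceNorm_le_of_forall_fullRank hσ.1 hσ.2.1 (by positivity) (fun ρ hρ => ?_) hρ
  refine traceNorm_le_of_entropy_production hL hσ.1 (fun ρ hρ => ?_) hρ ht
  have hg : (powOp σ 2 1 (weight σ (-1) ρ)).PosDef :=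
    powOp_posDef hσ.1.1 _ _ (weight_posDef hσ.1.1 _ hρ.1)
  have h1 := regularity_limit hL hσ.1.1 hr hreg hρ.1
  have h2 := hLS _ hg
  rw [ent2_powOp hσ.1.1 hρ, dirichletForm_two_relDual hσ.1.1 L hg] at h2
  have h3 := mul_le_mul_of_nonneg_left h2 hc
  linarith

end Mixing

end LogSobolev

end

theorem lemma4p3 {d : ℕ} (L : LogSobolev.Superop d) (hL : LogSobolev.IsLiouvillian L)
    (σ : LogSobolev.Mat d) (hσ : LogSobolev.IsPrimitive L σ)
    (α₂ : ℝ) (hα₂ : 0 < α₂)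
    (hLS : LogSobolev.LogSobolev2 σ (LogSobolev.relDual σ L) α₂) :
    (LogSobolev.WeaklyRegular σ L →
      ∀ ρ₀ : LogSobolev.Mat d, LogSobolev.IsState ρ₀ → ∀ t : ℝ, 0 ≤ t →
        LogSobolev.traceNorm (LogSobolev.expSemigroup (LogSobolev.hsDual L) t ρ₀ - σ) ≤
          Real.sqrt (2 * Real.log (1 / LogSobolev.minEigenvalue σ)) *
            Real.exp (-(α₂ * t) / 2)) ∧
    (LogSobolev.StronglyRegular σ L →
      ∀ ρ₀ : LogSobolev.Mat d, LogSobolev.IsState ρ₀ → ∀ t : ℝ, 0 ≤ t →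
        LogSobolev.traceNorm (LogSobolev.expSemigroup (LogSobolev.hsDual L) t ρ₀ - σ) ≤
          Real.sqrt (2 * Real.log (1 / LogSobolev.minEigenvalue σ)) *
            Real.exp (-(α₂ * t))) := by
  constructor
  · intro hreg ρ₀ hρ₀ t ht
    -- The coefficient 1/(p − 1) of the range p ≥ 2 equals s/(1 − s), which is asymptotic to s;
    -- hence c = 1.
    have h := LogSobolev.traceNorm_le_of_regularity hL hσ hLS (r := fun s => 1 / (1 / s - 1))
      (c := 1) zero_le_one ?_ ?_ hρ₀ ht
    · rwa [one_mul] at h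
    · have hc : ContinuousAt (fun s : ℝ => (1 - s)⁻¹) 0 :=
        (continuousAt_const.sub continuousAt_id).inv₀ (by simp)
      have h1 : Filter.Tendsto (fun s : ℝ => (1 - s)⁻¹) (nhdsWithin 0 (Set.Ioi 0)) (nhds 1) := by
        simpa using hc.tendsto.mono_left (nhdsWithin_le_nhds (s := Set.Ioi 0))
      refine h1.congr' ?_
      filter_upwards [self_mem_nhdsWithin] with s hs
      have hs0 : s ≠ 0 := ne_of_gt hs
      rw [div_sub' hs0, one_div_div, mul_one, inv_mul_eq_div, div_div_cancel_left' hs0]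
    · intro f hf s hs hs2
      refine (hreg f hf (1 / s)).2 ?_
      rw [le_div_iff₀ hs]
      linarith
  · intro hreg ρ₀ hρ₀ t ht
    -- The coefficient 2/p is exactly 2s, so c = 2 and the rate doubles.
    have h := LogSobolev.traceNorm_le_of_regularity hL hσ hLS (r := fun s => 2 / (1 / s))
      (c := 2) zero_le_two ?_ ?_ hρ₀ ht
    · rwa [show -(2 * α₂ * t) / 2 = -(α₂ * t) by ring] at h
    · refine tendsto_const_nhds.congr' ?_
      filter_upwards [self_mem_nhdsWithin] with s hs
      have hs0 : s ≠ 0 := ne_of_gt hs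
      rw [div_div_eq_mul_div, div_one, mul_comm, mul_assoc, mul_inv_cancel₀ hs0, mul_one]
    · intro f hf s hs hs2
      refine hreg f hf (1 / s) ?_
      rw [le_div_iff₀ hs]
      linarith
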